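/- Let $\mathsf{Gr}$ be the category of the real Grassmann algebras $\Lambda_n=\Lambda^\bullet(\mathbb R^n)$, $n\ge 0$, with parity preserving unital algebra homomorphisms; let $c_\Lambda:\mathbb R\to\Lambda$ and $\epsilon_\Lambda:\Lambda\to\mathbb R$ be the unique morphisms from and to $\Lambda_0=\mathbb R$. A supergroup is a group object in the category of functors $\mathsf{Gr}\to\mathsf{Sets}$, i.e. a functor $\mathsf{Gr}\to\mathsf{Grp}$; a (normal) super subgroup is a subfunctor whose values are (normal) subgroups; semidirect products of supergroups are formed pointwise. Let $\mathcal M$ be a (Fréchet) supermanifold, i.e. a functor from $\mathsf{Gr}$ to Hausdorff spaces with a supersmooth atlas of charts onto open subfunctors of the functors $\overline V:\Lambda\mapsto(\Lambda\otimes V)_{\bar 0}$, $V$ a Fréchet super vector space (a map is supersmooth if for each $\Lambda$ it is smooth with $\Lambda_{\bar 0}$-linear derivatives); morphisms are the natural transformations with continuous components that are supersmooth in charts. Let $\mathcal P(\Lambda)$ be the superpoint with $\mathcal P(\Lambda)(\Lambda')=\mathrm{Hom}_{\mathsf{Gr}}(\Lambda,\Lambda')$. For each $\Lambda\in\mathsf{Gr}$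 let $\mathrm{SDiff}(\mathcal M)(\Lambda)$ be the group of invertible elements of the monoid $\mathrm{Hom}(\mathcal P(\Lambda)\times\mathcal M,\mathcal M)$ with product $g\cdot f=g\circ(\mathrm{pr}_{\mathcal P(\Lambda)},f)$ and unit $\mathrm{pr}_{\mathcal M}$. A morphism $\varphi:\Lambda\to\Lambda'$ induces $\mathrm{SDiff}(\mathcal M)(\varphi):\sigma\mapsto\sigma\circ(\mathcal P(\varphi)\times\mathrm{id}_{\mathcal M})$. This makes $\mathrm{SDiff}(\mathcal M)$ a supergroup. Identify the automorphism group $\mathrm{Aut}(\mathcal M)$ with $\mathrm{SDiff}(\mathcal M)(\mathbb R)$ through $\mathcal P(\mathbb R)\times\mathcal M\cong\mathcal M$, and regard $\mathrm{Aut}(\mathcal M)$ as the constant supergroup $\Lambda\mapsto\mathrm{Aut}(\mathcal M)$. Then the subgroups $\mathcal N(\mathcal M)(\Lambda):=\ker\bigl(\mathrm{SDiff}(\mathcal M)(\epsilon_\Lambda)\bigr)$ form a normal super subgroup $\mathcal N(\mathcal M)$ of $\mathrm{SDiff}(\mathcal M)$. The group $\mathrm{Aut}(\mathcal M)$ acts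 on $\mathcal N(\mathcal M)$ by $a\cdot n=\mathrm{SDiff}(\mathcal M)(c_\Lambda)(a)\,n\,\mathrm{SDiff}(\mathcal M)(c_\Lambda)(a)^{-1}$ for $n\in\mathcal N(\mathcal M)(\Lambda)$, and for this action the maps $(n,a)\mapsto n\cdot\mathrm{SDiff}(\mathcal M)(c_\Lambda)(a)$ form an isomorphism of supergroups $$\mathcal N(\mathcal M)\rtimes\mathrm{Aut}(\mathcal M)\;\cong\;\mathrm{SDiff}(\mathcal M).$$ -/

import Mathlib

open Set Filter Topology CategoryTheory
open scoped TensorProduct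

noncomputable section

namespace SuperGeometry

universe u v w

set_option linter.unusedSectionVars false

/-! ## Differential calculus on locally convex spaces (Michal--Bastiani) -/

section Calculus

/-- `f` has directional derivative `w` at `x` in direction `v`:
`w = lim_{t → 0} (f (x + t v) - f x) / t`. -/
def HasDirDeriv {E : Type u} {F : Type v} [AddCommGroup E] [Module ℝ E]
    [AddCommGroup F] [Module ℝ F] [TopologicalSpace F] (f : E → F) (w : F) (x v : E) : Prop :=
  Tendsto (fun t : ℝ => t⁻¹ • (f (x + t • v) - f x)) (𝓝[≠] 0) (𝓝 w)

/-- `f` is `C^n` on the open set `s` in the sense of Michal--Bastiani: it is continuous on `s`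
and, if `n > 0`, its directional derivatives exist and form a `C^{n-1}` map `s × E → F`. -/
def CnOn {F : Type v} [AddCommGroup F] [Module ℝ F] [TopologicalSpace F] :
    ℕ → ∀ {E : Type u} [AddCommGroup E] [Module ℝ E] [TopologicalSpace E],
      (E → F) → Set E → Prop
  | 0, _, _, _, _, f, s => ContinuousOn f s
  | n + 1, E, _, _, _, f, s => ContinuousOn f s ∧ ∃ df : E × E → F,
      (∀ x ∈ s, ∀ v, HasDirDeriv f (df (x, v)) x v) ∧ CnOn n df (s ×ˢ univ)

variable {E : Type u} [AddCommGroup E] [Module ℝ E] [TopologicalSpace E]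
  {F : Type v} [AddCommGroup F] [Module ℝ F] [TopologicalSpace F]
  {G : Type w} [AddCommGroup G] [Module ℝ G] [TopologicalSpace G]

theorem HasDirDeriv.unique [T2Space F] {f : E → F} {w w' : F} {x v : E}
    (h : HasDirDeriv f w x v) (h' : HasDirDeriv f w' x v) : w = w' :=
  tendsto_nhds_unique h h'

theorem tendsto_line [ContinuousAdd E] [ContinuousSMul ℝ E] (x v : E) :
    Tendsto (fun t : ℝ => x + t • v) (𝓝[≠] 0) (𝓝 x) := by
  have : Continuous (fun t : ℝ => x + t • v) := by fun_prop
  simpa using (this.tendsto 0).mono_left nhdsWithin_le_nhds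

theorem HasDirDeriv.congr [ContinuousAdd E] [ContinuousSMul ℝ E] {f g : E → F} {w : F} {x v : E}
    {s : Set E} (hs : IsOpen s) (hx : x ∈ s) (hfg : EqOn f g s) (h : HasDirDeriv f w x v) :
    HasDirDeriv g w x v := by
  refine Tendsto.congr' ?_ h
  filter_upwards [(tendsto_line x v).eventually (hs.mem_nhds hx)] with t ht
  rw [hfg hx, hfg ht]

theorem HasDirDeriv.clm (f : E →L[ℝ] F) (x v : E) : HasDirDeriv f (f v) x v := by
  refine Tendsto.congr' ?_ tendsto_const_nhds
  filter_upwards [self_mem_nhdsWithin] with t ht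
  have : t ≠ 0 := ht
  simp [smul_smul, inv_mul_cancel₀ this]

theorem HasDirDeriv.prodMk {f : E → F} {g : E → G} {w : F} {w' : G} {x v : E}
    (hf : HasDirDeriv f w x v) (hg : HasDirDeriv g w' x v) :
    HasDirDeriv (fun y => (f y, g y)) (w, w') x v :=
  Tendsto.prodMk_nhds hf hg

theorem HasDirDeriv.clm_comp (L : F →L[ℝ] G) {f : E → F} {w : F} {x v : E}
    (h : HasDirDeriv f w x v) : HasDirDeriv (fun y => L (f y)) (L w) x v := by
  have := (L.continuous.tendsto w).comp h
  refine this.congr fun t => ?_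
  simp

theorem CnOn.continuousOn {n : ℕ} {f : E → F} {s : Set E} (h : CnOn n f s) :
    ContinuousOn f s := by
  cases n with
  | zero => exact h
  | succ n => exact h.1

theorem CnOn.of_succ {n : ℕ} {f : E → F} {s : Set E} (h : CnOn (n + 1) f s) : CnOn n f s := by
  induction n generalizing E with
  | zero => exact h.1
  | succ n ih =>
    obtain ⟨hc, df, hd, hdf⟩ := h
    exact ⟨hc, df, hd, ih hdf⟩

theorem CnOn.mono {n : ℕ} {f : E → F} {s t : Set E} (h : CnOn n f s) (hts : t ⊆ s) :
    CnOn n f t := by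
  induction n generalizing E with
  | zero => exact ContinuousOn.mono h hts
  | succ n ih =>
    obtain ⟨hc, df, hd, hdf⟩ := h
    exact ⟨hc.mono hts, df, fun x hx => hd x (hts hx), ih hdf (prod_mono hts subset_rfl)⟩

theorem CnOn.congr [ContinuousAdd E] [ContinuousSMul ℝ E] {n : ℕ} {f g : E → F} {s : Set E}
    (hs : IsOpen s) (h : CnOn n f s) (hfg : EqOn f g s) : CnOn n g s := by
  cases n with
  | zero => exact ContinuousOn.congr h hfg.symm
  | succ n =>
    obtain ⟨hc, df, hd, hdf⟩ := h
    exact ⟨hc.congr hfg.symm, df, fun x hx v => (hd x hx v).congr hs hx hfg, hdf⟩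

/-- Being `C^n` is a local property. -/
theorem CnOn.of_locally [ContinuousAdd E] [ContinuousSMul ℝ E] [T2Space F] {n : ℕ} {f : E → F}
    {s : Set E} (h : ∀ x ∈ s, ∃ t, IsOpen t ∧ x ∈ t ∧ CnOn n f t) : CnOn n f s := by
  induction n generalizing E with
  | zero =>
    intro x hx
    obtain ⟨t, ht, hxt, hf⟩ := h x hx
    exact (ContinuousOn.continuousAt hf (ht.mem_nhds hxt)).continuousWithinAt
  | succ n ih =>
    have hc : ContinuousOn f s := by
      intro x hx
      obtain ⟨t, ht, hxt, hf⟩ := h x hx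
      exact (ContinuousOn.continuousAt hf.1 (ht.mem_nhds hxt)).continuousWithinAt
    have key2 : ∀ p : E × E, ∃ w, (∃ w', HasDirDeriv f w' p.1 p.2) → HasDirDeriv f w p.1 p.2 := by
      intro p
      by_cases hp : ∃ w', HasDirDeriv f w' p.1 p.2
      · exact ⟨hp.choose, fun _ => hp.choose_spec⟩
      · exact ⟨0, fun h => absurd h hp⟩
    choose D hD using key2
    refine ⟨hc, D, fun x hx v => ?_, ih fun p hp => ?_⟩
    · obtain ⟨t, ht, hxt, hf, df', hd, -⟩ := h x hx
      exact hD (x, v) ⟨_, hd x hxt v⟩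
    · obtain ⟨t, ht, hxt, hf, df', hd, hdf'⟩ := h p.1 hp.1
      refine ⟨t ×ˢ univ, ht.prod isOpen_univ, ⟨hxt, mem_univ _⟩, ?_⟩
      refine hdf'.congr (ht.prod isOpen_univ) fun q hq => ?_
      exact (hd q.1 hq.1 q.2).unique (hD q ⟨_, hd q.1 hq.1 q.2⟩)

/-- A mean value argument, which yields the chain rule. -/
theorem tendsto_quotient [ContinuousAdd F] [ContinuousSMul ℝ F] [IsTopologicalAddGroup G]
    [ContinuousSMul ℝ G] [LocallyConvexSpace ℝ G] {g : F → G} {t : Set F} (ht : IsOpen t)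
    {dg : F × F → G} (hd : ∀ z ∈ t, ∀ v, HasDirDeriv g (dg (z, v)) z v)
    (hdg : ContinuousOn dg (t ×ˢ univ)) {y : F} (hy : y ∈ t) {q : ℝ → F} {q₀ : F}
    (hq : Tendsto q (𝓝[≠] 0) (𝓝 q₀)) :
    Tendsto (fun r : ℝ => r⁻¹ • (g (y + r • q r) - g y)) (𝓝[≠] 0) (𝓝 (dg (y, q₀))) := by
  intro O hO
  obtain ⟨C, ⟨hCn, hCc⟩, hCO⟩ :=
    (LocallyConvexSpace.convex_basis (𝕜 := ℝ) (dg (y, q₀))).mem_iff.1 hO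
  set W := interior C with hW
  have hWo : IsOpen W := isOpen_interior
  have hWc : Convex ℝ W := hCc.interior
  have hWm : dg (y, q₀) ∈ W := mem_interior_iff_mem_nhds.2 hCn
  have hA : ∀ᶠ p in 𝓝 (y, q₀), p.1 ∈ t ∧ dg p ∈ W := by
    have h1 : (t ×ˢ (univ : Set F)) ∈ 𝓝 (y, q₀) :=
      (ht.prod isOpen_univ).mem_nhds ⟨hy, mem_univ _⟩
    filter_upwards [h1, (hdg.continuousAt h1).eventually (hWo.mem_nhds hWm)] with p hp hp'
    exact ⟨hp.1, hp'⟩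
  have hcont : Tendsto (fun p : ℝ × F => (y + p.1 • p.2, p.2)) (𝓝 (0, q₀)) (𝓝 (y, q₀)) := by
    have : Continuous (fun p : ℝ × F => (y + p.1 • p.2, p.2)) := by fun_prop
    simpa using this.tendsto (0, q₀)
  have hA' := hcont.eventually hA
  rw [nhds_prod_eq] at hA'
  obtain ⟨pa, hpa, pb, hpb, hab⟩ := Filter.eventually_prod_iff.1 hA'
  obtain ⟨δ, hδ, hδa⟩ := Metric.eventually_nhds_iff.1 hpa
  have hsmall : ∀ᶠ r : ℝ in 𝓝[≠] 0, dist r 0 < δ :=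
    nhdsWithin_le_nhds (Metric.ball_mem_nhds 0 hδ)
  rw [Filter.mem_map]
  filter_upwards [hq.eventually hpb, hsmall, self_mem_nhdsWithin] with r hr hrδ hr0
  have hr0 : r ≠ 0 := hr0
  refine hCO (interior_subset (?_ : _ ∈ W))
  by_contra hnot
  obtain ⟨l, hl⟩ := geometric_hahn_banach_open_point hWc hWo hnot
  have hpt : ∀ σ ∈ Icc (0 : ℝ) 1, y + (σ * r) • q r ∈ t ∧ dg (y + (σ * r) • q r, q r) ∈ W := by
    intro σ hσ
    refine hab (hδa ?_) hr
    rw [Real.dist_eq, sub_zero] at hrδ ⊢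
    rw [abs_mul, abs_of_nonneg hσ.1]
    exact lt_of_le_of_lt (mul_le_of_le_one_left (abs_nonneg r) hσ.2) hrδ
  have hder : ∀ σ ∈ Icc (0 : ℝ) 1, HasDerivAt (fun σ : ℝ => l (g (y + (σ * r) • q r)))
      (l (dg (y + (σ * r) • q r, q r)) * r) σ := by
    intro σ hσ
    have h1 := (hd _ (hpt σ hσ).1 (q r)).clm_comp l
    have h2 : HasDerivAt (fun ρ : ℝ => l (g (y + ρ • q r)))
        (l (dg (y + (σ * r) • q r, q r))) (σ * r) := by
      rw [hasDerivAt_iff_tendsto_slope_zero]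
      refine Tendsto.congr (fun s => ?_) h1
      rw [add_assoc, ← add_smul]
    have h3 : HasDerivAt (fun σ : ℝ => σ * r) r σ := by
      simpa using (hasDerivAt_id σ).mul_const r
    exact HasDerivAt.comp σ h2 h3
  obtain ⟨c, hc, hcs⟩ := exists_hasDerivAt_eq_slope _ _ zero_lt_one
    (fun σ hσ => (hder σ hσ).continuousAt.continuousWithinAt)
    (fun σ hσ => hder σ (Ioo_subset_Icc_self hσ))
  have h5 := hl _ (hpt c (Ioo_subset_Icc_self hc)).2
  have h6 : l (r⁻¹ • (g (y + r • q r) - g y)) = l (dg (y + (c * r) • q r, q r)) := by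
    have : l (g (y + r • q r)) - l (g y) = l (dg (y + (c * r) • q r, q r)) * r := by
      rw [hcs]; simp
    rw [map_smul, map_sub, this, smul_eq_mul]
    field_simp
  exact absurd h6 (ne_of_gt h5)

theorem HasDirDeriv.comp [IsTopologicalAddGroup F] [ContinuousSMul ℝ F] [IsTopologicalAddGroup G]
    [ContinuousSMul ℝ G] [LocallyConvexSpace ℝ G] {g : F → G} {t : Set F} (ht : IsOpen t)
    {dg : F × F → G} (hd : ∀ z ∈ t, ∀ v, HasDirDeriv g (dg (z, v)) z v)
    (hdg : ContinuousOn dg (t ×ˢ univ)) {f : E → F} {x v : E} {q₀ : F} (hx : f x ∈ t)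
    (hf : HasDirDeriv f q₀ x v) : HasDirDeriv (g ∘ f) (dg (f x, q₀)) x v := by
  refine (tendsto_quotient ht hd hdg hx hf).congr' ?_
  filter_upwards [self_mem_nhdsWithin] with r hr
  have hr : r ≠ 0 := hr
  simp [smul_smul, mul_inv_cancel₀ hr]

theorem CnOn.clm (n : ℕ) (f : E →L[ℝ] F) (s : Set E) : CnOn n f s := by
  induction n generalizing E with
  | zero => exact f.continuous.continuousOn
  | succ n ih =>
    exact ⟨f.continuous.continuousOn, f ∘ Prod.snd, fun x _ v => HasDirDeriv.clm f x v,
      ih (f.comp (ContinuousLinearMap.snd ℝ E E)) _⟩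

theorem CnOn.const [ContinuousAdd F] (n : ℕ) (c : F) (s : Set E) :
    CnOn n (fun _ : E => c) s := by
  cases n with
  | zero => exact continuousOn_const
  | succ n =>
    refine ⟨continuousOn_const, fun _ => 0, fun x _ v => ?_, CnOn.clm n (0 : E × E →L[ℝ] F) _⟩
    simpa [HasDirDeriv] using tendsto_const_nhds

theorem CnOn.prodMk {n : ℕ} {f : E → F} {g : E → G} {s : Set E} (hf : CnOn n f s)
    (hg : CnOn n g s) : CnOn n (fun x => (f x, g x)) s := by
  induction n generalizing E with
  | zero => exact ContinuousOn.prodMk hf hg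
  | succ n ih =>
    obtain ⟨hfc, df, hfd, hdf⟩ := hf
    obtain ⟨hgc, dg, hgd, hdg⟩ := hg
    exact ⟨hfc.prodMk hgc, fun p => (df p, dg p),
      fun x hx v => (hfd x hx v).prodMk (hgd x hx v), ih hdf hdg⟩

theorem CnOn.comp_clm {n : ℕ} {f : F → G} {t : Set F} (hf : CnOn n f t) (L : E →L[ℝ] F) :
    CnOn n (f ∘ L) (L ⁻¹' t) := by
  induction n generalizing E F with
  | zero => exact ContinuousOn.comp hf L.continuous.continuousOn fun _ h => h
  | succ n ih =>
    obtain ⟨hfc, df, hfd, hdf⟩ := hf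
    refine ⟨hfc.comp L.continuous.continuousOn fun _ h => h, df ∘ L.prodMap L,
      fun x hx v => ?_, (ih hdf (L.prodMap L)).mono fun p hp => ⟨hp.1, mem_univ _⟩⟩
    refine Tendsto.congr (fun t => ?_) (hfd (L x) hx (L v))
    simp

theorem CnOn.comp [IsTopologicalAddGroup F] [ContinuousSMul ℝ F] [IsTopologicalAddGroup G]
    [ContinuousSMul ℝ G] [LocallyConvexSpace ℝ G] {n : ℕ} {g : F → G} {t : Set F}
    (ht : IsOpen t) (hg : CnOn n g t) {f : E → F} {s : Set E} (hf : CnOn n f s)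
    (hst : MapsTo f s t) : CnOn n (g ∘ f) s := by
  induction n generalizing E F with
  | zero => exact ContinuousOn.comp hg hf hst
  | succ n ih =>
    obtain ⟨hgc, dg, hgd, hdg⟩ := hg
    have hf' := hf.of_succ
    obtain ⟨hfc, df, hfd, hdf⟩ := hf
    refine ⟨hgc.comp hfc hst, dg ∘ fun p => (f p.1, df p), fun x hx v => ?_, ?_⟩
    · exact HasDirDeriv.comp ht hgd hdg.continuousOn (hst hx) (hfd x hx v)
    · refine ih (ht.prod isOpen_univ) hdg (CnOn.prodMk ?_ hdf) fun p hp => ⟨hst hp.1, mem_univ _⟩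
      exact (hf'.comp_clm (ContinuousLinearMap.fst ℝ E E)).mono fun p hp => hp.1

theorem CnOn.add [IsTopologicalAddGroup F] [ContinuousSMul ℝ F] [LocallyConvexSpace ℝ F] {n : ℕ}
    {f g : E → F} {s : Set E} (hf : CnOn n f s) (hg : CnOn n g s) :
    CnOn n (fun x => f x + g x) s :=
  CnOn.comp isOpen_univ (CnOn.clm n (ContinuousLinearMap.fst ℝ F F +
    ContinuousLinearMap.snd ℝ F F) univ) (hf.prodMk hg) fun _ _ => mem_univ _

/-- `f` is supersmooth on the open set `s`, with respect to actions of a ring `R` on both sides: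
it is smooth (`C^∞`), and its derivative at each point of `s` is `R`-linear. (Additivity of the
derivative is automatic for `C^1` maps.) -/
def SupersmoothOn (R : Type*) [Ring R] [Module R E] [Module R F] (f : E → F) (s : Set E) : Prop :=
  (∀ n, CnOn n f s) ∧
    ∀ x ∈ s, ∀ v w, ∀ a : R, HasDirDeriv f w x v → HasDirDeriv f (a • w) x (a • v)

section

variable {R : Type*} [Ring R] [Module R E] [Module R F] [Module R G]

theorem SupersmoothOn.continuousOn {f : E → F} {s : Set E} (h : SupersmoothOn R f s) :
    ContinuousOn f s := h.1 0

theorem SupersmoothOn.mono {f : E → F} {s t : Set E} (h : SupersmoothOn R f s) (hts : t ⊆ s) :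
    SupersmoothOn R f t :=
  ⟨fun n => (h.1 n).mono hts, fun x hx => h.2 x (hts hx)⟩

theorem SupersmoothOn.congr [ContinuousAdd E] [ContinuousSMul ℝ E] {f g : E → F} {s : Set E}
    (hs : IsOpen s) (h : SupersmoothOn R f s) (hfg : EqOn f g s) : SupersmoothOn R g s :=
  ⟨fun n => (h.1 n).congr hs hfg, fun x hx v w a hw =>
    (h.2 x hx v w a (hw.congr hs hx hfg.symm)).congr hs hx hfg⟩

theorem SupersmoothOn.of_locally [ContinuousAdd E] [ContinuousSMul ℝ E] [T2Space F] {f : E → F}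
    {s : Set E} (h : ∀ x ∈ s, ∃ t, IsOpen t ∧ x ∈ t ∧ SupersmoothOn R f t) :
    SupersmoothOn R f s := by
  refine ⟨fun n => CnOn.of_locally fun x hx => ?_, fun x hx => ?_⟩
  · obtain ⟨t, ht, hxt, hf⟩ := h x hx
    exact ⟨t, ht, hxt, hf.1 n⟩
  · obtain ⟨t, ht, hxt, hf⟩ := h x hx
    exact hf.2 x hxt

theorem SupersmoothOn.comp [IsTopologicalAddGroup F] [ContinuousSMul ℝ F]
    [IsTopologicalAddGroup G] [ContinuousSMul ℝ G] [LocallyConvexSpace ℝ G] [T2Space G]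
    {g : F → G} {t : Set F} (ht : IsOpen t) (hg : SupersmoothOn R g t) {f : E → F} {s : Set E}
    (hf : SupersmoothOn R f s) (hst : MapsTo f s t) : SupersmoothOn R (g ∘ f) s := by
  refine ⟨fun n => (hg.1 n).comp ht (hf.1 n) hst, fun x hx v w a hw => ?_⟩
  obtain ⟨-, df, hfd, -⟩ := hf.1 1
  obtain ⟨-, dg, hgd, hdg⟩ := hg.1 1
  have h1 := HasDirDeriv.comp ht hgd hdg.continuousOn (hst hx) (hfd x hx v)
  have h2 := HasDirDeriv.comp ht hgd hdg.continuousOn (hst hx)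
    (hf.2 x hx v _ a (hfd x hx v))
  have h3 := (hg.2 _ (hst hx) _ _ a (hgd (f x) (hst hx) (df (x, v)))).unique
    (hgd (f x) (hst hx) (a • df (x, v)))
  rw [← h3, h1.unique hw] at h2
  exact h2

theorem SupersmoothOn.prodMk {f : E → F} {g : E → G} {s : Set E} (hf : SupersmoothOn R f s)
    (hg : SupersmoothOn R g s) : SupersmoothOn R (fun x => (f x, g x)) s := by
  refine ⟨fun n => (hf.1 n).prodMk (hg.1 n), fun x hx v w a hw => ?_⟩
  have h1 : HasDirDeriv f w.1 x v := hw.clm_comp (ContinuousLinearMap.fst ℝ F G)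
  have h2 : HasDirDeriv g w.2 x v := hw.clm_comp (ContinuousLinearMap.snd ℝ F G)
  exact (hf.2 x hx v _ a h1).prodMk (hg.2 x hx v _ a h2)

theorem SupersmoothOn.clm [T2Space F] (L : E →L[ℝ] F) (hL : ∀ (a : R) v, L (a • v) = a • L v)
    (s : Set E) : SupersmoothOn R L s := by
  refine ⟨fun n => CnOn.clm n L s, fun x _ v w a hw => ?_⟩
  rw [hw.unique (HasDirDeriv.clm L x v), ← hL]
  exact HasDirDeriv.clm L x (a • v)

theorem SupersmoothOn.prodMap {E' : Type*} [AddCommGroup E'] [Module ℝ E'] [TopologicalSpace E']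
    [Module R E'] [IsTopologicalAddGroup E] [ContinuousSMul ℝ E] [IsTopologicalAddGroup E']
    [ContinuousSMul ℝ E'] [T2Space E] [T2Space E'] [IsTopologicalAddGroup F] [ContinuousSMul ℝ F]
    [LocallyConvexSpace ℝ F] [T2Space F] [IsTopologicalAddGroup G] [ContinuousSMul ℝ G]
    [LocallyConvexSpace ℝ G] [T2Space G] {f : E → F} {s : Set E} {g : E' → G} {t : Set E'}
    (hf : SupersmoothOn R f s) (hs : IsOpen s) (ht : IsOpen t) (hg : SupersmoothOn R g t) :
    SupersmoothOn R (Prod.map f g) (s ×ˢ t) :=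
  SupersmoothOn.prodMk
    (hf.comp hs (SupersmoothOn.clm (ContinuousLinearMap.fst ℝ E E') (fun _ _ => rfl) _)
      fun _ h => h.1)
    (hg.comp ht (SupersmoothOn.clm (ContinuousLinearMap.snd ℝ E E') (fun _ _ => rfl) _)
      fun _ h => h.2)

theorem SupersmoothOn.const [ContinuousAdd F] [T2Space F] (c : F) (s : Set E) :
    SupersmoothOn R (fun _ : E => c) s := by
  have h0 : ∀ x v : E, HasDirDeriv (fun _ : E => c) 0 x v := fun x v => by
    simp [HasDirDeriv]
  refine ⟨fun n => CnOn.const n c s, fun x _ v w a hw => ?_⟩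
  rw [hw.unique (h0 x v), smul_zero]
  exact h0 _ _

theorem SupersmoothOn.add [IsTopologicalAddGroup F] [ContinuousSMul ℝ F] [LocallyConvexSpace ℝ F]
    [T2Space F] {f g : E → F} {s : Set E} (hf : SupersmoothOn R f s) (hg : SupersmoothOn R g s) :
    SupersmoothOn R (fun x => f x + g x) s :=
  SupersmoothOn.comp isOpen_univ (SupersmoothOn.clm (ContinuousLinearMap.fst ℝ F F +
    ContinuousLinearMap.snd ℝ F F) (fun a v => by simp) univ) (hf.prodMk hg) fun _ _ => mem_univ _

theorem SupersmoothOn.sum [IsTopologicalAddGroup F] [ContinuousSMul ℝ F] [LocallyConvexSpace ℝ F]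
    [T2Space F] {ι : Type*} (I : Finset ι) {f : ι → E → F} {s : Set E}
    (hf : ∀ i, SupersmoothOn R (f i) s) : SupersmoothOn R (fun x => ∑ i ∈ I, f i x) s := by
  classical
  induction I using Finset.induction_on with
  | empty => simpa using SupersmoothOn.const (0 : F) s
  | insert i I hi ih => simpa only [Finset.sum_insert hi] using (hf i).add ih

end

section Mul

variable {A : Type v} [Ring A] [Algebra ℝ A] [TopologicalSpace A] [IsTopologicalRing A]
  [ContinuousSMul ℝ A] [LocallyConvexSpace ℝ A]

theorem HasDirDeriv.mul {f g : E → A} {w w' : A} {x v : E}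
    [ContinuousAdd E] [ContinuousSMul ℝ E] {s : Set E} (hs : IsOpen s) (hx : x ∈ s)
    (hgc : ContinuousOn g s) (hf : HasDirDeriv f w x v) (hg : HasDirDeriv g w' x v) :
    HasDirDeriv (fun y => f y * g y) (w * g x + f x * w') x v := by
  have hgt : Tendsto (fun t : ℝ => g (x + t • v)) (𝓝[≠] 0) (𝓝 (g x)) :=
    (hgc.continuousAt (hs.mem_nhds hx)).tendsto.comp (tendsto_line x v)
  refine Tendsto.congr (fun t => ?_)
    ((Tendsto.mul hf hgt).add (Tendsto.const_mul (f x) hg))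
  rw [smul_mul_assoc, mul_smul_comm, ← smul_add]
  congr 1
  noncomm_ring

theorem CnOn.mul [IsTopologicalAddGroup E] [ContinuousSMul ℝ E] {n : ℕ} {f g : E → A} {s : Set E}
    (hs : IsOpen s) (hf : CnOn n f s) (hg : CnOn n g s) : CnOn n (fun x => f x * g x) s := by
  induction n generalizing E with
  | zero => exact ContinuousOn.mul hf hg
  | succ n ih =>
    have hf' := hf.of_succ
    have hg' := hg.of_succ
    obtain ⟨hfc, df, hfd, hdf⟩ := hf
    obtain ⟨hgc, dg, hgd, hdg⟩ := hg
    refine ⟨hfc.mul hgc, fun p => df p * g p.1 + f p.1 * dg p,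
      fun x hx v => (hfd x hx v).mul hs hx hgc (hgd x hx v), CnOn.add ?_ ?_⟩
    · exact ih (hs.prod isOpen_univ) hdf
        ((hg'.comp_clm (ContinuousLinearMap.fst ℝ E E)).mono fun p hp => hp.1)
    · exact ih (hs.prod isOpen_univ)
        ((hf'.comp_clm (ContinuousLinearMap.fst ℝ E E)).mono fun p hp => hp.1) hdg

theorem SupersmoothOn.mul {R : Type*} [Ring R] [Module R E] [Module R A] [T2Space A]
    (h₁ : ∀ (a : R) (x y : A), a • (x * y) = (a • x) * y)
    (h₂ : ∀ (a : R) (x y : A), a • (x * y) = x * (a • y))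
    [IsTopologicalAddGroup E] [ContinuousSMul ℝ E] {f g : E → A} {s : Set E}
    (hs : IsOpen s) (hf : SupersmoothOn R f s) (hg : SupersmoothOn R g s) :
    SupersmoothOn R (fun x => f x * g x) s := by
  refine ⟨fun n => (hf.1 n).mul hs (hg.1 n), fun x hx v w a hw => ?_⟩
  obtain ⟨-, df, hfd, -⟩ := hf.1 1
  obtain ⟨-, dg, hgd, -⟩ := hg.1 1
  rw [hw.unique ((hfd x hx v).mul hs hx hg.continuousOn (hgd x hx v)), smul_add, h₁, h₂]
  exact (hf.2 x hx v _ a (hfd x hx v)).mul hs hx hg.continuousOn (hg.2 x hx v _ a (hgd x hx v))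

end Mul

end Calculus

/-! ## Grassmann algebras -/

/-- The category of finite-dimensional Grassmann algebras has one object `Λ_n` for each
natural number `n`. -/
structure Gr where
  /-- the number of odd generators -/
  n : ℕ

namespace Gr

/-- The Grassmann algebra `Λ_n` on the `n` odd generators `τ_1, …, τ_n`. -/
abbrev alg (Λ : Gr) : Type := ExteriorAlgebra ℝ (Fin Λ.n → ℝ)

/-- The even (`i = 0`) and the odd (`i = 1`) part of `Λ_n`. -/
abbrev part (Λ : Gr) (i : ZMod 2) : Submodule ℝ Λ.alg :=
  CliffordAlgebra.evenOdd (0 : QuadraticForm ℝ (Fin Λ.n → ℝ)) i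

/-- The even part of `Λ_n`, as a ring. -/
abbrev even (Λ : Gr) : Subalgebra ℝ Λ.alg :=
  CliffordAlgebra.even (0 : QuadraticForm ℝ (Fin Λ.n → ℝ))

/-- The generator `τ_i` of `Λ_n`. -/
def τ (Λ : Gr) (i : Fin Λ.n) : Λ.alg := ExteriorAlgebra.ι ℝ (Pi.single i 1)

theorem τ_mem (Λ : Gr) (i : Fin Λ.n) : Λ.τ i ∈ Λ.part 1 :=
  CliffordAlgebra.ι_mem_evenOdd_one _ _

/-- Morphisms of Grassmann algebras: parity preserving homomorphisms of (unital) algebras. -/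
@[ext]
structure Hom (Λ Λ' : Gr) where
  /-- the underlying algebra homomorphism -/
  toAlgHom : Λ.alg →ₐ[ℝ] Λ'.alg
  map_part : ∀ i, ∀ x ∈ Λ.part i, toAlgHom x ∈ Λ'.part i

instance : Category Gr where
  Hom := Hom
  id Λ := ⟨AlgHom.id ℝ Λ.alg, fun _ _ h => h⟩
  comp φ ψ := ⟨ψ.toAlgHom.comp φ.toAlgHom, fun i x h => ψ.map_part i _ (φ.map_part i x h)⟩

@[ext]
theorem hom_ext {Λ Λ' : Gr} {φ ψ : Λ ⟶ Λ'} (h : ∀ i, φ.toAlgHom (Λ.τ i) = ψ.toAlgHom (Λ.τ i)) :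
    φ = ψ := by
  refine Hom.ext (ExteriorAlgebra.hom_ext (LinearMap.pi_ext' fun i => LinearMap.ext_ring ?_))
  exact h i

theorem id_apply {Λ : Gr} (x : Λ.alg) : (𝟙 Λ : Λ ⟶ Λ).toAlgHom x = x := rfl

theorem comp_apply {Λ Λ' Λ'' : Gr} (φ : Λ ⟶ Λ') (ψ : Λ' ⟶ Λ'') (x : Λ.alg) :
    (φ ≫ ψ).toAlgHom x = ψ.toAlgHom (φ.toAlgHom x) := rfl

theorem ι_mul_ι (Λ : Gr) (v w : Fin Λ.n → ℝ) :
    ExteriorAlgebra.ι ℝ v * ExteriorAlgebra.ι ℝ w =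
      -(ExteriorAlgebra.ι ℝ w * ExteriorAlgebra.ι ℝ v) :=
  eq_neg_of_add_eq_zero_left (ExteriorAlgebra.ι_add_mul_swap v w)

theorem ι_mul_ι_comm (Λ : Gr) (v w : Fin Λ.n → ℝ) (y : Λ.alg) :
    ExteriorAlgebra.ι ℝ v * ExteriorAlgebra.ι ℝ w * y =
      y * (ExteriorAlgebra.ι ℝ v * ExteriorAlgebra.ι ℝ w) := by
  induction y using ExteriorAlgebra.induction with
  | algebraMap r => exact (Algebra.commutes r _).symm
  | ι x =>
    rw [mul_assoc, ι_mul_ι Λ w x, mul_neg, ← mul_assoc, ι_mul_ι Λ v x, neg_mul, neg_neg, mul_assoc]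
  | mul a b ha hb => rw [← mul_assoc, ha, mul_assoc, hb, mul_assoc]
  | add a b ha hb => rw [mul_add, ha, hb, add_mul]

/-- Even elements are central. -/
theorem even_comm (Λ : Gr) {x : Λ.alg} (hx : x ∈ Λ.part 0) (y : Λ.alg) : x * y = y * x := by
  induction x, hx using CliffordAlgebra.even_induction with
  | algebraMap r => exact Algebra.commutes r _
  | add a b _ _ ha hb => rw [add_mul, ha, hb, mul_add]
  | ι_mul_ι_mul m₁ m₂ a _ ha =>
    rw [mul_assoc, ha]
    have := ι_mul_ι_comm Λ m₁ m₂ y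
    simp only [ExteriorAlgebra.ι] at this
    rw [← mul_assoc, this, mul_assoc]

theorem odd_mul_ι (Λ : Gr) {x : Λ.alg} (hx : x ∈ Λ.part 1) (v : Fin Λ.n → ℝ) :
    x * ExteriorAlgebra.ι ℝ v = -(ExteriorAlgebra.ι ℝ v * x) := by
  induction x, hx using CliffordAlgebra.odd_induction with
  | ι w => exact ι_mul_ι Λ w v
  | add a b _ _ ha hb => rw [add_mul, ha, hb, mul_add, neg_add]
  | ι_mul_ι_mul m₁ m₂ a _ ha =>
    have := ι_mul_ι_comm Λ m₁ m₂ (ExteriorAlgebra.ι ℝ v)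
    simp only [ExteriorAlgebra.ι] at this ha ⊢
    rw [mul_assoc, ha, mul_neg, ← mul_assoc, this, mul_assoc]

theorem odd_mul_odd (Λ : Gr) {x y : Λ.alg} (hx : x ∈ Λ.part 1) (hy : y ∈ Λ.part 1) :
    x * y = -(y * x) := by
  induction y, hy using CliffordAlgebra.odd_induction with
  | ι w => exact odd_mul_ι Λ hx w
  | add a b _ _ ha hb => rw [mul_add, ha, hb, add_mul, neg_add]
  | ι_mul_ι_mul m₁ m₂ a _ ha =>
    have := ι_mul_ι_comm Λ m₁ m₂ x
    simp only [ExteriorAlgebra.ι] at this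
    rw [← mul_assoc, ← this, mul_assoc, ha, mul_neg, mul_assoc, mul_assoc, mul_assoc]

theorem odd_mul_self (Λ : Gr) {x : Λ.alg} (hx : x ∈ Λ.part 1) : x * x = 0 := by
  have h := odd_mul_odd Λ hx hx
  have h2 : (2 : ℝ) • (x * x) = 0 := by rw [two_smul]; nth_rw 1 [h]; simp
  exact (smul_eq_zero.1 h2).resolve_left two_ne_zero

/-- `Λ_n` is free: a morphism `Λ_n ⟶ Λ` amounts to a choice of `n` odd elements of `Λ`. -/
def homEquiv (Λ Λ' : Gr) : (Λ ⟶ Λ') ≃ (Fin Λ.n → Λ'.part 1) where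
  toFun φ i := ⟨φ.toAlgHom (Λ.τ i), φ.map_part 1 _ (Λ.τ_mem i)⟩
  invFun g :=
    have h (m : Fin Λ.n → ℝ) : (Fintype.linearCombination ℝ (fun i => (g i : Λ'.alg)) m) ∈
        Λ'.part 1 := by
      rw [Fintype.linearCombination_apply]
      exact Submodule.sum_mem _ fun i _ => Submodule.smul_mem _ _ (g i).2
    { toAlgHom := ExteriorAlgebra.lift ℝ ⟨Fintype.linearCombination ℝ (fun i => (g i : Λ'.alg)),
        fun m => odd_mul_self Λ' (h m)⟩
      map_part := by
        set φ : Λ.alg →ₐ[ℝ] Λ'.alg := ExteriorAlgebra.lift ℝ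
          ⟨Fintype.linearCombination ℝ (fun i => (g i : Λ'.alg)), fun m => odd_mul_self Λ' (h m)⟩
          with hφ
        have hι (m : Fin Λ.n → ℝ) : φ (CliffordAlgebra.ι 0 m) ∈ Λ'.part 1 := by
          have : φ (ExteriorAlgebra.ι ℝ m) = _ := ExteriorAlgebra.lift_ι_apply _ _ _ _
          simp only [ExteriorAlgebra.ι] at this
          rw [this]
          exact h m
        have hm (i : ZMod 2) (m₁ m₂ : Fin Λ.n → ℝ) (x : Λ.alg) (hx : φ x ∈ Λ'.part i) :
            φ (CliffordAlgebra.ι 0 m₁ * CliffordAlgebra.ι 0 m₂ * x) ∈ Λ'.part i := by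
          rw [map_mul, map_mul]
          have h2 := SetLike.mul_mem_graded (SetLike.mul_mem_graded (hι m₁) (hι m₂)) hx
          have : (1 : ZMod 2) + 1 + i = i := by rw [show (1 : ZMod 2) + 1 = 0 from rfl, zero_add]
          rwa [this] at h2
        intro i x hx
        obtain rfl | rfl : i = 0 ∨ i = 1 := (by decide : ∀ i : ZMod 2, i = 0 ∨ i = 1) i
        · induction x, hx using CliffordAlgebra.even_induction with
          | algebraMap r =>
            rw [AlgHom.commutes]
            exact SetLike.algebraMap_mem_graded _ _
          | add a b _ _ ha hb => rw [map_add]; exact Submodule.add_mem _ ha hb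
          | ι_mul_ι_mul m₁ m₂ a _ ha => exact hm 0 m₁ m₂ a ha
        · induction x, hx using CliffordAlgebra.odd_induction with
          | ι w => exact hι w
          | add a b _ _ ha hb => rw [map_add]; exact Submodule.add_mem _ ha hb
          | ι_mul_ι_mul m₁ m₂ a _ ha => exact hm 1 m₁ m₂ a ha }
  left_inv φ := by
    ext i
    simp only [τ]
    rw [ExteriorAlgebra.lift_ι_apply, Fintype.linearCombination_apply_single, one_smul]
  right_inv g := by
    ext i
    simp only [τ]
    rw [ExteriorAlgebra.lift_ι_apply, Fintype.linearCombination_apply_single, one_smul]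

theorem homEquiv_apply (Λ Λ' : Gr) (φ : Λ ⟶ Λ') (i : Fin Λ.n) :
    (homEquiv Λ Λ' φ i : Λ'.alg) = φ.toAlgHom (Λ.τ i) := rfl

/-- The Grassmann algebra `Λ_0 = ℝ`. -/
abbrev base : Gr := ⟨0⟩

/-- The morphism that sends all generators to `0`. -/
def zeroHom (Λ Λ' : Gr) : Λ ⟶ Λ' := (homEquiv Λ Λ').symm 0

/-- The initial morphism `c_Λ : ℝ ⟶ Λ`. -/
def c (Λ : Gr) : base ⟶ Λ := zeroHom base Λ

/-- The terminal morphism `ε_Λ : Λ ⟶ ℝ`, which kills all odd generators. -/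
def ε (Λ : Gr) : Λ ⟶ base := zeroHom Λ base

end Gr

/-! ## Super vector spaces and the associated functors -/

section Tensor

variable {S S' : Type v} [AddCommGroup S] [Module ℝ S] [AddCommGroup S'] [Module ℝ S']
  {V : Type u} [AddCommGroup V] [Module ℝ V] [TopologicalSpace V]
  {W : Type w} [AddCommGroup W] [Module ℝ W] [TopologicalSpace W]

/-- Contraction `S ⊗ V → V` with a linear functional on `S`. -/
def contract (V : Type u) [AddCommGroup V] [Module ℝ V] (l : S →ₗ[ℝ] ℝ) : S ⊗[ℝ] V →ₗ[ℝ] V :=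
  (TensorProduct.lid ℝ V).toLinearMap ∘ₗ l.rTensor V

@[simp]
theorem contract_tmul (l : S →ₗ[ℝ] ℝ) (s : S) (x : V) : contract V l (s ⊗ₜ x) = l s • x := by
  simp [contract]

/-- The topology on `S ⊗ V`, for a finite-dimensional vector space `S`: the coarsest one for
which all contractions with functionals on `S` are continuous. (A basis of `S` with `d` elements
identifies `S ⊗ V` with `V ^ d`, and this is the product topology.) -/
instance tensorTopology : TopologicalSpace (S ⊗[ℝ] V) :=
  ⨅ l : S →ₗ[ℝ] ℝ, TopologicalSpace.induced (contract V l) inferInstance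

theorem continuous_contract (l : S →ₗ[ℝ] ℝ) : Continuous (contract V l) :=
  continuous_iff_le_induced.2 (iInf_le _ l)

theorem continuous_tensor_iff {X : Type*} [TopologicalSpace X] {f : X → S ⊗[ℝ] V} :
    Continuous f ↔ ∀ l : S →ₗ[ℝ] ℝ, Continuous fun x => contract V l (f x) := by
  rw [continuous_iInf_rng]
  exact forall_congr' fun l => continuous_induced_rng

instance [IsTopologicalAddGroup V] : IsTopologicalAddGroup (S ⊗[ℝ] V) :=
  topologicalAddGroup_iInf fun l => topologicalAddGroup_induced (contract V l)

instance [ContinuousSMul ℝ V] : ContinuousSMul ℝ (S ⊗[ℝ] V) :=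
  continuousSMul_iInf fun l => continuousSMul_induced (contract V l)

instance [IsTopologicalAddGroup V] [ContinuousSMul ℝ V] [LocallyConvexSpace ℝ V] :
    LocallyConvexSpace ℝ (S ⊗[ℝ] V) :=
  LocallyConvexSpace.iInf fun l => LocallyConvexSpace.induced (contract V l)

instance [T2Space V] : T2Space (S ⊗[ℝ] V) := by
  refine T2Space.of_injective_continuous (f := fun (x : S ⊗[ℝ] V) (l : S →ₗ[ℝ] ℝ) =>
    contract V l x) ?_ (continuous_pi fun l => continuous_contract l)
  intro x y hxy
  let b := Module.Free.chooseBasis ℝ S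
  apply (TensorProduct.equivFinsuppOfBasisLeft (N := V) b).injective
  have key : ∀ (z : S ⊗[ℝ] V) i, TensorProduct.equivFinsuppOfBasisLeft b z i =
      contract V (b.coord i) z := by
    intro z i
    induction z with
    | zero => simp
    | tmul s v => simp
    | add a b ha hb => simp only [map_add, Finsupp.add_apply, ha, hb]
  ext i
  rw [key, key]
  exact congrFun hxy (b.coord i)

/-- The continuous linear map `a ⊗ f`. -/
def tensorMap (a : S →ₗ[ℝ] S') (f : V →L[ℝ] W) : S ⊗[ℝ] V →L[ℝ] S' ⊗[ℝ] W where
  toLinearMap := TensorProduct.map a f.toLinearMap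
  cont := by
    refine continuous_tensor_iff.2 fun l => ?_
    have : ∀ x : S ⊗[ℝ] V, contract W l (TensorProduct.map a f.toLinearMap x) =
        f (contract V (l ∘ₗ a) x) := by
      intro x
      induction x with
      | zero => simp
      | tmul s v => simp
      | add x y hx hy => simp only [map_add, hx, hy]
    exact (f.continuous.comp (continuous_contract (l ∘ₗ a))).congr fun x => (this x).symm

@[simp]
theorem tensorMap_tmul (a : S →ₗ[ℝ] S') (f : V →L[ℝ] W) (s : S) (x : V) :
    tensorMap a f (s ⊗ₜ x) = a s ⊗ₜ f x := rfl

theorem tensorMap_comp {S'' : Type v} [AddCommGroup S''] [Module ℝ S''] {X : Type*}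
    [AddCommGroup X] [Module ℝ X] [TopologicalSpace X] (a : S →ₗ[ℝ] S') (f : V →L[ℝ] W)
    (b : S' →ₗ[ℝ] S'') (g : W →L[ℝ] X) (x : S ⊗[ℝ] V) :
    tensorMap b g (tensorMap a f x) = tensorMap (b ∘ₗ a) (g.comp f) x := by
  induction x with
  | zero => simp only [map_zero]
  | tmul s v => simp
  | add x y hx hy => simp only [map_add, hx, hy]

instance [IsTopologicalAddGroup V] : ContinuousAdd (S ⊗[ℝ] V) :=
  IsTopologicalAddGroup.toContinuousAdd

theorem prodRight_eq (x : S ⊗[ℝ] (V × W)) : TensorProduct.prodRight ℝ ℝ S V W x =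
    (tensorMap LinearMap.id (ContinuousLinearMap.fst ℝ V W) x,
      tensorMap LinearMap.id (ContinuousLinearMap.snd ℝ V W) x) := by
  induction x with
  | zero => simp only [map_zero, Prod.mk_zero_zero]
  | tmul s v => simp
  | add x y hx hy => simp only [map_add, hx, hy, Prod.mk_add_mk]

/-- `S ⊗ (V × W) ≅ (S ⊗ V) × (S ⊗ W)`. -/
def tensorProdEquiv (S : Type v) (V : Type u) (W : Type w) [AddCommGroup S] [Module ℝ S]
    [AddCommGroup V] [Module ℝ V] [TopologicalSpace V] [IsTopologicalAddGroup V]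
    [AddCommGroup W] [Module ℝ W] [TopologicalSpace W] [IsTopologicalAddGroup W] :
    (S ⊗[ℝ] (V × W)) ≃L[ℝ] (S ⊗[ℝ] V) × (S ⊗[ℝ] W) where
  toLinearEquiv := TensorProduct.prodRight ℝ ℝ S V W
  continuous_toFun := by
    refine Continuous.congr ?_ fun x => (prodRight_eq x).symm
    exact (ContinuousLinearMap.continuous _).prodMk (ContinuousLinearMap.continuous _)
  continuous_invFun := by
    have : ∀ x : (S ⊗[ℝ] V) × (S ⊗[ℝ] W), (TensorProduct.prodRight ℝ ℝ S V W).symm x =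
        tensorMap LinearMap.id (ContinuousLinearMap.inl ℝ V W) x.1 +
          tensorMap LinearMap.id (ContinuousLinearMap.inr ℝ V W) x.2 := by
      intro x
      rfl
    refine Continuous.congr ?_ fun x => (this x).symm
    exact ((ContinuousLinearMap.continuous _).comp continuous_fst).add
      ((ContinuousLinearMap.continuous _).comp continuous_snd)

end Tensor

/-- Real Fréchet spaces: complete metrizable Hausdorff locally convex spaces. -/
class FrechetSpace (V : Type u) [AddCommGroup V] [Module ℝ V] [UniformSpace V] : Prop extends
  IsUniformAddGroup V, ContinuousSMul ℝ V, LocallyConvexSpace ℝ V, T2Space V, CompleteSpace V,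
  FirstCountableTopology V

instance (V : Type u) (W : Type v) [AddCommGroup V] [Module ℝ V] [UniformSpace V] [FrechetSpace V]
    [AddCommGroup W] [Module ℝ W] [UniformSpace W] [FrechetSpace W] : FrechetSpace (V × W) where

instance : FrechetSpace PUnit.{u + 1} where
  convex_basis _ := Filter.hasBasis_iff.2 fun t =>
    ⟨fun ht => ⟨t, ⟨ht, (Set.subsingleton_of_subsingleton (s := t)).convex⟩, subset_rfl⟩,
      fun ⟨_, hi, hit⟩ => mem_of_superset hi.1 hit⟩

instance (ι : Type) [Fintype ι] : FrechetSpace (ι → ℝ) where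

/-- A Fréchet super vector space `V = V₀ ⊕ V₁`, given by its even and its odd part. -/
structure SuperSpace where
  /-- the even part -/
  V₀ : Type u
  /-- the odd part -/
  V₁ : Type u
  [add₀ : AddCommGroup V₀]
  [mod₀ : Module ℝ V₀]
  [uni₀ : UniformSpace V₀]
  [fre₀ : FrechetSpace V₀]
  [add₁ : AddCommGroup V₁]
  [mod₁ : Module ℝ V₁]
  [uni₁ : UniformSpace V₁]
  [fre₁ : FrechetSpace V₁]

attribute [instance] SuperSpace.add₀ SuperSpace.mod₀ SuperSpace.uni₀ SuperSpace.fre₀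
  SuperSpace.add₁ SuperSpace.mod₁ SuperSpace.uni₁ SuperSpace.fre₁

namespace Gr

/-- `Λ_0̄` acts on the even and on the odd part of `Λ` by multiplication. -/
instance (Λ : Gr) (i : ZMod 2) : Module Λ.even (Λ.part i) where
  smul a x := ⟨a.1 * x.1, by simpa using SetLike.mul_mem_graded a.2 x.2⟩
  one_smul x := Subtype.ext (one_mul _)
  mul_smul a b x := Subtype.ext (mul_assoc _ _ _)
  smul_zero a := Subtype.ext (mul_zero _)
  smul_add a x y := Subtype.ext (mul_add _ _ _)
  add_smul a b x := Subtype.ext (add_mul _ _ _)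
  zero_smul x := Subtype.ext (zero_mul _)

theorem coe_smul {Λ : Gr} {i : ZMod 2} (a : Λ.even) (x : Λ.part i) :
    ((a • x : Λ.part i) : Λ.alg) = a.1 * x.1 := rfl

instance (Λ : Gr) (i : ZMod 2) : IsScalarTower ℝ Λ.even (Λ.part i) where
  smul_assoc r a x := Subtype.ext (smul_mul_assoc r a.1 x.1)

instance (Λ : Gr) (i : ZMod 2) : SMulCommClass ℝ Λ.even (Λ.part i) where
  smul_comm r a x := Subtype.ext (mul_smul_comm r a.1 x.1).symm

/-- The restriction of a morphism of Grassmann algebras to even or odd parts. -/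
def Hom.restrict {Λ Λ' : Gr} (φ : Λ ⟶ Λ') (i : ZMod 2) : Λ.part i →ₗ[ℝ] Λ'.part i :=
  φ.toAlgHom.toLinearMap.restrict (φ.map_part i)

end Gr

namespace SuperSpace

/-- The value at `Λ` of the functor `V̄` associated with a super vector space `V`:
`V̄(Λ) = (Λ ⊗ V)_0̄ = (Λ_0̄ ⊗ V_0̄) ⊕ (Λ_1̄ ⊗ V_1̄)`. It is a locally convex space and a module over
`Λ_0̄`. -/
abbrev bar (V : SuperSpace.{u}) (Λ : Gr) : Type u :=
  (Λ.part 0 ⊗[ℝ] V.V₀) × (Λ.part 1 ⊗[ℝ] V.V₁)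

/-- The value of the functor `V̄` at a morphism. -/
def barMap (V : SuperSpace.{u}) {Λ Λ' : Gr} (φ : Λ ⟶ Λ') : V.bar Λ →L[ℝ] V.bar Λ' :=
  (tensorMap (Gr.Hom.restrict φ 0) (ContinuousLinearMap.id ℝ V.V₀)).prodMap
    (tensorMap (Gr.Hom.restrict φ 1) (ContinuousLinearMap.id ℝ V.V₁))

/-- The direct sum of super vector spaces. -/
abbrev prod (V : SuperSpace.{u}) (W : SuperSpace.{v}) : SuperSpace.{max u v} where
  V₀ := V.V₀ × W.V₀
  V₁ := V.V₁ × W.V₁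

/-- `(V ⊕ W)‾ ≅ V̄ × W̄`. -/
def prodEquiv (V : SuperSpace.{u}) (W : SuperSpace.{v}) (Λ : Gr) :
    (V.prod W).bar Λ ≃L[ℝ] V.bar Λ × W.bar Λ :=
  ((tensorProdEquiv (Λ.part 0) V.V₀ W.V₀).prodCongr (tensorProdEquiv (Λ.part 1) V.V₁ W.V₁)).trans
    (ContinuousLinearEquiv.prodProdProdComm ℝ _ _ _ _)

theorem prodEquiv_apply (V : SuperSpace.{u}) (W : SuperSpace.{v}) (Λ : Gr)
    (x : (V.prod W).bar Λ) : prodEquiv V W Λ x =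
      ((tensorMap LinearMap.id (ContinuousLinearMap.fst ℝ V.V₀ W.V₀) x.1,
        tensorMap LinearMap.id (ContinuousLinearMap.fst ℝ V.V₁ W.V₁) x.2),
      (tensorMap LinearMap.id (ContinuousLinearMap.snd ℝ V.V₀ W.V₀) x.1,
        tensorMap LinearMap.id (ContinuousLinearMap.snd ℝ V.V₁ W.V₁) x.2)) :=
  congrArg₂ (fun (a : (Λ.part 0 ⊗[ℝ] V.V₀) × (Λ.part 0 ⊗[ℝ] W.V₀))
    (b : (Λ.part 1 ⊗[ℝ] V.V₁) × (Λ.part 1 ⊗[ℝ] W.V₁)) => ((a.1, b.1), (a.2, b.2)))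
    (prodRight_eq x.1) (prodRight_eq x.2)

theorem tensorMap_even_smul {Λ : Gr} {i : ZMod 2} {A : Type u} {B : Type v} [AddCommGroup A]
    [Module ℝ A] [TopologicalSpace A] [AddCommGroup B] [Module ℝ B] [TopologicalSpace B]
    (f : A →L[ℝ] B) (a : Λ.even) (x : Λ.part i ⊗[ℝ] A) :
    tensorMap LinearMap.id f (a • x) = a • tensorMap LinearMap.id f x := by
  induction x with
  | zero => simp only [map_zero, smul_zero]
  | tmul s v => simp [TensorProduct.smul_tmul']
  | add x y hx hy => simp only [map_add, smul_add, hx, hy]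

theorem prodEquiv_smul (V : SuperSpace.{u}) (W : SuperSpace.{v}) (Λ : Gr) (a : Λ.even)
    (x : (V.prod W).bar Λ) : prodEquiv V W Λ (a • x) = a • prodEquiv V W Λ x := by
  rw [prodEquiv_apply, prodEquiv_apply]
  exact Prod.ext (Prod.ext (tensorMap_even_smul _ a x.1) (tensorMap_even_smul _ a x.2))
    (Prod.ext (tensorMap_even_smul _ a x.1) (tensorMap_even_smul _ a x.2))

theorem prodEquiv_symm_smul (V : SuperSpace.{u}) (W : SuperSpace.{v}) (Λ : Gr) (a : Λ.even)
    (x : V.bar Λ × W.bar Λ) :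
    (prodEquiv V W Λ).symm (a • x) = a • (prodEquiv V W Λ).symm x := by
  apply (prodEquiv V W Λ).injective
  rw [prodEquiv_smul, ContinuousLinearEquiv.apply_symm_apply,
    ContinuousLinearEquiv.apply_symm_apply]

theorem tensorMap_restrict {Λ Λ' : Gr} (φ : Λ ⟶ Λ') {i : ZMod 2} {A : Type u} {B : Type v}
    [AddCommGroup A] [Module ℝ A] [TopologicalSpace A] [AddCommGroup B] [Module ℝ B]
    [TopologicalSpace B] (f : A →L[ℝ] B) (x : Λ.part i ⊗[ℝ] A) :
    tensorMap LinearMap.id f (tensorMap (Gr.Hom.restrict φ i) (ContinuousLinearMap.id ℝ A) x) =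
      tensorMap (Gr.Hom.restrict φ i) (ContinuousLinearMap.id ℝ B) (tensorMap LinearMap.id f x) := by
  rw [tensorMap_comp, tensorMap_comp]
  rfl

theorem prodEquiv_barMap (V : SuperSpace.{u}) (W : SuperSpace.{v}) {Λ Λ' : Gr} (φ : Λ ⟶ Λ')
    (x : (V.prod W).bar Λ) : prodEquiv V W Λ' ((V.prod W).barMap φ x) =
      (V.barMap φ (prodEquiv V W Λ x).1, W.barMap φ (prodEquiv V W Λ x).2) := by
  rw [prodEquiv_apply, prodEquiv_apply]
  exact Prod.ext (Prod.ext (tensorMap_restrict φ _ x.1) (tensorMap_restrict φ _ x.2))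
    (Prod.ext (tensorMap_restrict φ _ x.1) (tensorMap_restrict φ _ x.2))

end SuperSpace

/-! ## Supermanifolds -/

/-- A chart of a functor `M : Gr ⥤ Top`: a natural isomorphism between an open subfunctor of `M`
and an open subfunctor (a superdomain) of `V̄`, for a Fréchet super vector space `V`. Here an open
subfunctor is one all of whose values are open subsets. -/
structure Chart (M : Gr ⥤ TopCat.{u}) where
  /-- the model space -/
  V : SuperSpace.{u}
  /-- the homeomorphisms between open subsets of `M(Λ)` and `V̄(Λ)` -/
  hom : ∀ Λ : Gr, OpenPartialHomeomorph (M.obj Λ) (V.bar Λ)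
  map_source : ∀ {Λ Λ' : Gr} (φ : Λ ⟶ Λ'), ∀ x ∈ (hom Λ).source, M.map φ x ∈ (hom Λ').source
  naturality : ∀ {Λ Λ' : Gr} (φ : Λ ⟶ Λ'), ∀ x ∈ (hom Λ).source,
    hom Λ' (M.map φ x) = V.barMap φ (hom Λ x)

/-- A (Fréchet) supermanifold: a functor `M` from Grassmann algebras to (Hausdorff) spaces with an
atlas of charts onto superdomains whose changes of charts are supersmooth, that is, smooth
with `Λ_0̄`-linear derivatives for each `Λ` (they are natural in `Λ` because charts are). In
particular each `M(Λ)` is a Fréchet manifold. The atlas determines a maximal atlas, and morphisms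
depend only on the latter. -/
structure Supermanifold where
  /-- the underlying functor -/
  functor : Gr ⥤ TopCat.{u}
  [t2 : ∀ Λ, T2Space (functor.obj Λ)]
  /-- the atlas -/
  atlas : Set (Chart functor)
  cover : ∀ (Λ : Gr) (x : functor.obj Λ), ∃ c ∈ atlas, x ∈ (c.hom Λ).source
  compatible : ∀ c ∈ atlas, ∀ d ∈ atlas, ∀ Λ : Gr,
    SupersmoothOn Λ.even (d.hom Λ ∘ (c.hom Λ).symm)
      ((c.hom Λ).target ∩ (c.hom Λ).symm ⁻¹' (d.hom Λ).source)

attribute [instance] Supermanifold.t2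

namespace Supermanifold

/-- The space `M(Λ)` of `Λ`-points of a supermanifold. -/
abbrev pt (M : Supermanifold.{u}) (Λ : Gr) : Type u := M.functor.obj Λ

/-- The map `M(φ) : M(Λ) → M(Λ')`. -/
def map (M : Supermanifold.{u}) {Λ Λ' : Gr} (φ : Λ ⟶ Λ') : C(M.pt Λ, M.pt Λ') :=
  (M.functor.map φ).hom

theorem map_id (M : Supermanifold.{u}) (Λ : Gr) (x : M.pt Λ) : M.map (𝟙 Λ) x = x := by
  simp [map]

theorem map_comp (M : Supermanifold.{u}) {Λ Λ' Λ'' : Gr} (φ : Λ ⟶ Λ') (ψ : Λ' ⟶ Λ'')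
    (x : M.pt Λ) : M.map (φ ≫ ψ) x = M.map ψ (M.map φ x) := by
  simp [map]

/-- A morphism of supermanifolds: a natural transformation all of whose components are continuous,
and which is supersmooth in all charts. -/
@[ext]
structure Hom (M : Supermanifold.{u}) (N : Supermanifold.{v}) where
  /-- the components of the natural transformation -/
  app : ∀ Λ : Gr, M.pt Λ → N.pt Λ
  naturality : ∀ {Λ Λ' : Gr} (φ : Λ ⟶ Λ') (x : M.pt Λ),
    app Λ' (M.map φ x) = N.map φ (app Λ x)
  continuous : ∀ Λ, Continuous (app Λ)
  supersmooth : ∀ c ∈ M.atlas, ∀ d ∈ N.atlas, ∀ Λ : Gr,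
    SupersmoothOn Λ.even (d.hom Λ ∘ app Λ ∘ (c.hom Λ).symm)
      ((c.hom Λ).target ∩ (c.hom Λ).symm ⁻¹' (app Λ ⁻¹' (d.hom Λ).source))

namespace Hom

theorem isOpen_dom {M : Supermanifold.{u}} {N : Supermanifold.{v}} {Λ : Gr}
    {f : M.pt Λ → N.pt Λ} (hf : Continuous f) (c : Chart M.functor) (d : Chart N.functor) :
    IsOpen ((c.hom Λ).target ∩ (c.hom Λ).symm ⁻¹' (f ⁻¹' (d.hom Λ).source)) :=
  (c.hom Λ).isOpen_inter_preimage_symm ((d.hom Λ).open_source.preimage hf)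

/-- The identity morphism. -/
def id (M : Supermanifold.{u}) : Hom M M where
  app _ x := x
  naturality _ _ := rfl
  continuous _ := continuous_id
  supersmooth c hc d hd Λ := M.compatible c hc d hd Λ

/-- Composition of morphisms. -/
def comp {M : Supermanifold.{u}} {N : Supermanifold.{v}} {P : Supermanifold.{w}} (g : Hom N P)
    (f : Hom M N) : Hom M P where
  app Λ x := g.app Λ (f.app Λ x)
  naturality φ x := by rw [f.naturality, g.naturality]
  continuous Λ := (g.continuous Λ).comp (f.continuous Λ)
  supersmooth c hc e he Λ := by
    refine SupersmoothOn.of_locally fun y hy => ?_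
    obtain ⟨d, hd, hyd⟩ := N.cover Λ (f.app Λ ((c.hom Λ).symm y))
    have ho := isOpen_dom ((g.continuous Λ).comp (f.continuous Λ)) c e
    have ho' := isOpen_dom (f.continuous Λ) c d
    refine ⟨_, ho.inter ho', ⟨hy, hy.1, hyd⟩, ?_⟩
    refine SupersmoothOn.congr (ho.inter ho') (SupersmoothOn.comp
      (isOpen_dom (g.continuous Λ) d e) (g.supersmooth d hd e he Λ)
      ((f.supersmooth c hc d hd Λ).mono inter_subset_right) ?_) ?_
    · rintro z ⟨⟨hz1, hz2⟩, -, hz3⟩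
      refine ⟨(d.hom Λ).map_source hz3, ?_⟩
      have := (d.hom Λ).left_inv hz3
      simp only [Function.comp_apply, mem_preimage] at this hz2 ⊢
      rw [this]
      exact hz2
    · rintro z ⟨⟨hz1, hz2⟩, -, hz3⟩
      have := (d.hom Λ).left_inv hz3
      simp only [Function.comp_apply] at this ⊢
      rw [this]

@[simp]
theorem id_app (M : Supermanifold.{u}) (Λ : Gr) (x : M.pt Λ) : (Hom.id M).app Λ x = x := rfl

@[simp]
theorem comp_app {M : Supermanifold.{u}} {N : Supermanifold.{v}} {P : Supermanifold.{w}}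
    (g : Hom N P) (f : Hom M N) (Λ : Gr) (x : M.pt Λ) :
    (g.comp f).app Λ x = g.app Λ (f.app Λ x) := rfl

theorem ext' {M : Supermanifold.{u}} {N : Supermanifold.{v}} {f g : Hom M N}
    (h : ∀ Λ x, f.app Λ x = g.app Λ x) : f = g :=
  Hom.ext (funext fun Λ => funext fun x => h Λ x)

end Hom

/-! ### Products -/

theorem prodEquiv_supersmooth (V : SuperSpace.{u}) (W : SuperSpace.{v}) (Λ : Gr)
    (s : Set ((V.prod W).bar Λ)) : SupersmoothOn Λ.even (SuperSpace.prodEquiv V W Λ) s :=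
  SupersmoothOn.clm (E := (V.prod W).bar Λ) (F := V.bar Λ × W.bar Λ) (R := Λ.even)
    (SuperSpace.prodEquiv V W Λ).toContinuousLinearMap
    (fun a v => SuperSpace.prodEquiv_smul V W Λ a v) s

theorem prodEquiv_symm_supersmooth (V : SuperSpace.{u}) (W : SuperSpace.{v}) (Λ : Gr)
    (s : Set (V.bar Λ × W.bar Λ)) :
    SupersmoothOn Λ.even (SuperSpace.prodEquiv V W Λ).symm s :=
  SupersmoothOn.clm (F := (V.prod W).bar Λ) (E := V.bar Λ × W.bar Λ) (R := Λ.even)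
    (SuperSpace.prodEquiv V W Λ).symm.toContinuousLinearMap
    (fun a v => SuperSpace.prodEquiv_symm_smul V W Λ a v) s

/-- The functor `Λ ↦ M(Λ) × N(Λ)`. -/
def prodFunctor (M : Gr ⥤ TopCat.{u}) (N : Gr ⥤ TopCat.{v}) : Gr ⥤ TopCat.{max u v} where
  obj Λ := TopCat.of (M.obj Λ × N.obj Λ)
  map φ := TopCat.ofHom ((M.map φ).hom.prodMap (N.map φ).hom)
  map_id Λ := by
    refine TopCat.hom_ext (ContinuousMap.ext fun x => ?_)
    change (M.map (𝟙 Λ) x.1, N.map (𝟙 Λ) x.2) = x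
    simp
  map_comp φ ψ := by
    refine TopCat.hom_ext (ContinuousMap.ext fun x => ?_)
    change (M.map (φ ≫ ψ) x.1, N.map (φ ≫ ψ) x.2) =
      (M.map ψ (M.map φ x.1), N.map ψ (N.map φ x.2))
    simp

end Supermanifold

/-- The product of two charts. -/
def Chart.prod {M : Gr ⥤ TopCat.{u}} {N : Gr ⥤ TopCat.{v}} (c : Chart M) (d : Chart N) :
    Chart (Supermanifold.prodFunctor M N) where
  V := c.V.prod d.V
  hom Λ := ((c.hom Λ).prod (d.hom Λ)).transHomeomorph
    (SuperSpace.prodEquiv c.V d.V Λ).symm.toHomeomorph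
  map_source φ x hx := ⟨c.map_source φ _ hx.1, d.map_source φ _ hx.2⟩
  naturality {Λ Λ'} φ x hx := by
    change (SuperSpace.prodEquiv c.V d.V Λ').symm
      (c.hom Λ' (M.map φ x.1), d.hom Λ' (N.map φ x.2)) = _
    rw [c.naturality φ _ hx.1, d.naturality φ _ hx.2, ContinuousLinearEquiv.symm_apply_eq,
      SuperSpace.prodEquiv_barMap]
    change _ = (c.V.barMap φ ((SuperSpace.prodEquiv c.V d.V Λ)
      ((SuperSpace.prodEquiv c.V d.V Λ).symm (c.hom Λ x.1, d.hom Λ x.2))).1,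
      d.V.barMap φ ((SuperSpace.prodEquiv c.V d.V Λ)
      ((SuperSpace.prodEquiv c.V d.V Λ).symm (c.hom Λ x.1, d.hom Λ x.2))).2)
    rw [ContinuousLinearEquiv.apply_symm_apply]

namespace Supermanifold

/-- The product of supermanifolds: `(M × N)(Λ) = M(Λ) × N(Λ)`, with products of charts. -/
def prod (M : Supermanifold.{u}) (N : Supermanifold.{v}) : Supermanifold.{max u v} where
  functor := prodFunctor M.functor N.functor
  t2 Λ := inferInstanceAs (T2Space (M.pt Λ × N.pt Λ))
  atlas := {e | ∃ c ∈ M.atlas, ∃ d ∈ N.atlas, e = Chart.prod c d}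
  cover Λ x := by
    obtain ⟨c, hc, hxc⟩ := M.cover Λ x.1
    obtain ⟨d, hd, hxd⟩ := N.cover Λ x.2
    exact ⟨_, ⟨c, hc, d, hd, rfl⟩, hxc, hxd⟩
  compatible := by
    rintro _ ⟨c, hc, d, hd, rfl⟩ _ ⟨c', hc', d', hd', rfl⟩ Λ
    have h1 := (M.compatible c hc c' hc' Λ).prodMap
      ((c.hom Λ).isOpen_inter_preimage_symm (c'.hom Λ).open_source)
      ((d.hom Λ).isOpen_inter_preimage_symm (d'.hom Λ).open_source)
      (N.compatible d hd d' hd' Λ)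
    have h2 := prodEquiv_supersmooth c.V d.V Λ
    have h3 := prodEquiv_symm_supersmooth c'.V d'.V Λ univ
    refine SupersmoothOn.comp isOpen_univ h3 (SupersmoothOn.comp
      (((c.hom Λ).isOpen_inter_preimage_symm (c'.hom Λ).open_source).prod
        ((d.hom Λ).isOpen_inter_preimage_symm (d'.hom Λ).open_source)) h1 (h2 _) ?_)
      fun _ _ => mem_univ _
    rintro z ⟨⟨hz1, hz2⟩, hz3, hz4⟩
    exact ⟨⟨hz1, hz3⟩, hz2, hz4⟩

namespace Hom

/-- The first projection. -/
def fst (M : Supermanifold.{u}) (N : Supermanifold.{v}) : Hom (M.prod N) M where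
  app _ x := x.1
  naturality _ _ := rfl
  continuous Λ := continuous_fst (X := M.pt Λ) (Y := N.pt Λ)
  supersmooth := by
    rintro _ ⟨c, hc, d, hd, rfl⟩ c' hc' Λ
    have h2 := fun s => SupersmoothOn.comp (R := Λ.even) isOpen_univ
      (SupersmoothOn.clm (E := c.V.bar Λ × d.V.bar Λ) (F := c.V.bar Λ) (R := Λ.even)
        (ContinuousLinearMap.fst ℝ (c.V.bar Λ) (d.V.bar Λ)) (fun _ _ => rfl) univ)
      (prodEquiv_supersmooth c.V d.V Λ s) fun _ _ => mem_univ _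
    refine SupersmoothOn.comp
      ((c.hom Λ).isOpen_inter_preimage_symm (c'.hom Λ).open_source)
      (M.compatible c hc c' hc' Λ) (h2 _) ?_
    rintro z ⟨⟨hz1, hz2⟩, hz3⟩
    exact ⟨hz1, hz3⟩

/-- The second projection. -/
def snd (M : Supermanifold.{u}) (N : Supermanifold.{v}) : Hom (M.prod N) N where
  app _ x := x.2
  naturality _ _ := rfl
  continuous Λ := continuous_snd (X := M.pt Λ) (Y := N.pt Λ)
  supersmooth := by
    rintro _ ⟨c, hc, d, hd, rfl⟩ d' hd' Λ
    have h2 := fun s => SupersmoothOn.comp (R := Λ.even) isOpen_univ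
      (SupersmoothOn.clm (E := c.V.bar Λ × d.V.bar Λ) (F := d.V.bar Λ) (R := Λ.even)
        (ContinuousLinearMap.snd ℝ (c.V.bar Λ) (d.V.bar Λ)) (fun _ _ => rfl) univ)
      (prodEquiv_supersmooth c.V d.V Λ s) fun _ _ => mem_univ _
    refine SupersmoothOn.comp
      ((d.hom Λ).isOpen_inter_preimage_symm (d'.hom Λ).open_source)
      (N.compatible d hd d' hd' Λ) (h2 _) ?_
    rintro z ⟨⟨hz1, hz2⟩, hz3⟩
    exact ⟨hz2, hz3⟩

/-- The morphism `(f, g)` into a product. -/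
def lift {L : Supermanifold.{w}} {M : Supermanifold.{u}} {N : Supermanifold.{v}} (f : Hom L M)
    (g : Hom L N) : Hom L (M.prod N) where
  app Λ x := (f.app Λ x, g.app Λ x)
  naturality φ x := Prod.ext (f.naturality φ x) (g.naturality φ x)
  continuous Λ := (f.continuous Λ).prodMk (g.continuous Λ)
  supersmooth := by
    rintro b hb _ ⟨c, hc, d, hd, rfl⟩ Λ
    have h3 := prodEquiv_symm_supersmooth c.V d.V Λ univ
    refine SupersmoothOn.comp isOpen_univ h3 (SupersmoothOn.prodMk
      ((f.supersmooth b hb c hc Λ).mono ?_) ((g.supersmooth b hb d hd Λ).mono ?_))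
      fun _ _ => mem_univ _
    · rintro z ⟨hz1, hz2, hz3⟩
      exact ⟨hz1, hz2⟩
    · rintro z ⟨hz1, hz2, hz3⟩
      exact ⟨hz1, hz3⟩

@[simp]
theorem fst_app (M : Supermanifold.{u}) (N : Supermanifold.{v}) (Λ : Gr) (x : M.pt Λ × N.pt Λ) :
    (fst M N).app Λ x = x.1 := rfl

@[simp]
theorem snd_app (M : Supermanifold.{u}) (N : Supermanifold.{v}) (Λ : Gr) (x : M.pt Λ × N.pt Λ) :
    (snd M N).app Λ x = x.2 := rfl

@[simp]
theorem lift_app {L : Supermanifold.{w}} {M : Supermanifold.{u}} {N : Supermanifold.{v}}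
    (f : Hom L M) (g : Hom L N) (Λ : Gr) (x : L.pt Λ) :
    (lift f g).app Λ x = (f.app Λ x, g.app Λ x) := rfl

end Hom

end Supermanifold

/-! ### Superpoints -/

namespace Gr

/-- The usual topology of the finite-dimensional vector space `Λ`: the coarsest one for
which all linear functionals are continuous. -/
instance algTopology (Λ : Gr) : TopologicalSpace Λ.alg :=
  ⨅ l : Λ.alg →ₗ[ℝ] ℝ, TopologicalSpace.induced l inferInstance

theorem continuous_alg_iff {Λ : Gr} {X : Type*} [TopologicalSpace X] {f : X → Λ.alg} :
    Continuous f ↔ ∀ l : Λ.alg →ₗ[ℝ] ℝ, Continuous fun x => l (f x) := by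
  rw [continuous_iInf_rng]
  exact forall_congr' fun l => continuous_induced_rng

theorem continuous_functional {Λ : Gr} (l : Λ.alg →ₗ[ℝ] ℝ) : Continuous l :=
  continuous_iff_le_induced.2 (iInf_le _ l)

instance (Λ : Gr) : IsTopologicalAddGroup Λ.alg :=
  topologicalAddGroup_iInf fun l => topologicalAddGroup_induced l

instance (Λ : Gr) : ContinuousSMul ℝ Λ.alg :=
  continuousSMul_iInf fun l => continuousSMul_induced l

instance (Λ : Gr) : LocallyConvexSpace ℝ Λ.alg :=
  LocallyConvexSpace.iInf fun l => LocallyConvexSpace.induced l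

instance (Λ : Gr) : T2Space Λ.alg := by
  refine T2Space.of_injective_continuous (f := fun (x : Λ.alg) (l : Λ.alg →ₗ[ℝ] ℝ) => l x) ?_
    (continuous_pi fun l => continuous_functional l)
  intro x y hxy
  let b := Module.Free.chooseBasis ℝ Λ.alg
  exact b.ext_elem fun i => congrFun hxy (b.coord i)

instance (Λ : Gr) : IsTopologicalRing Λ.alg where
  continuous_mul := by
    refine continuous_alg_iff.2 fun l => ?_
    let b : Module.Basis (Finset (Fin Λ.n)) ℝ Λ.alg :=
      (Pi.basisFun ℝ (Fin Λ.n)).ExteriorAlgebra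
    have h : ∀ p : Λ.alg × Λ.alg, l (p.1 * p.2) =
        ∑ i, ∑ j, b.coord i p.1 * b.coord j p.2 * l (b i * b j) := by
      intro p
      conv_lhs => rw [← b.sum_repr p.1, ← b.sum_repr p.2]
      simp only [Finset.sum_mul, Finset.mul_sum, map_sum, smul_mul_assoc, mul_smul_comm, map_smul,
        smul_eq_mul, Module.Basis.coord_apply]
      rw [Finset.sum_comm]
      refine Finset.sum_congr rfl fun i _ => Finset.sum_congr rfl fun j _ => ?_
      ring
    simp only [h]
    refine continuous_finsetSum _ fun i _ => continuous_finsetSum _ fun j _ => ?_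
    exact (((continuous_functional _).comp continuous_fst).mul
      ((continuous_functional _).comp continuous_snd)).mul continuous_const

/-- The projection of `Λ` onto its odd part. -/
def oddProj (Λ : Gr) : Λ.alg →ₗ[ℝ] Λ.part 1 :=
  Submodule.projectionOnto (Λ.part 1) (Λ.part 0) (CliffordAlgebra.evenOdd_isCompl _).symm

end Gr

/-- The super vector space `ℝ^{0|n}`. -/
abbrev oddSpace (n : ℕ) : SuperSpace.{0} where
  V₀ := PUnit
  V₁ := Fin n → ℝ

namespace Superpoint

/-- `Λ_1̄ ⊗ ℝ^n ≅ (Λ_1̄)^n`. -/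
def tensorPi (Λ : Gr) (n : ℕ) : (Λ.part 1 ⊗[ℝ] (Fin n → ℝ)) ≃ₗ[ℝ] (Fin n → Λ.part 1) :=
  TensorProduct.piScalarRight ℝ ℝ (Λ.part 1) (Fin n)

@[simp]
theorem tensorPi_tmul (Λ : Gr) (n : ℕ) (s : Λ.part 1) (v : Fin n → ℝ) (j : Fin n) :
    tensorPi Λ n (s ⊗ₜ v) j = v j • s :=
  congrFun (TensorProduct.piScalarRightHom_tmul ℝ ℝ (Λ.part 1) (Fin n) s v) j

/-- `Hom(P, Λ) ≅ Λ_1̄ ⊗ ℝ^n = (ℝ^{0|n})‾(Λ)` for `P = Λ_n`. -/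
def coord (P Λ : Gr) : (P ⟶ Λ) ≃ (oddSpace P.n).bar Λ where
  toFun g := (0, (tensorPi Λ P.n).symm (Gr.homEquiv P Λ g))
  invFun x := (Gr.homEquiv P Λ).symm (tensorPi Λ P.n x.2)
  left_inv g := by simp
  right_inv x := by
    refine Prod.ext ?_ (by simp)
    have h : ∀ z : Λ.part 0 ⊗[ℝ] PUnit.{1}, z = 0 := by
      intro z
      induction z with
      | zero => rfl
      | tmul s v => exact TensorProduct.tmul_zero _ s
      | add x y hx hy => rw [hx, hy, add_zero]
    exact (h _).symm

/-- The set `𝒫(P)(Λ) = Hom(P, Λ)` of `Λ`-points of a superpoint. -/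
def Pts (P Λ : Gr) : Type := P ⟶ Λ

instance (P Λ : Gr) : TopologicalSpace (Pts P Λ) :=
  TopologicalSpace.induced (coord P Λ) inferInstance

/-- `coord` is a homeomorphism. -/
def coordHomeo (P Λ : Gr) : Pts P Λ ≃ₜ (oddSpace P.n).bar Λ :=
  Equiv.toHomeomorphOfIsInducing (X := Pts P Λ) (coord P Λ) ⟨rfl⟩

theorem tensorPi_tensorMap {Λ Λ' : Gr} (n : ℕ) (a : Λ.part 1 →ₗ[ℝ] Λ'.part 1)
    (x : Λ.part 1 ⊗[ℝ] (Fin n → ℝ)) (j : Fin n) :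
    tensorPi Λ' n
      (tensorMap a (ContinuousLinearMap.id ℝ (Fin n → ℝ)) x) j =
    a (tensorPi Λ n x j) := by
  induction x with
  | zero => simp only [map_zero, Pi.zero_apply]
  | tmul s v => simp
  | add x y hx hy => simp only [map_add, Pi.add_apply, hx, hy]

theorem coord_comp {P Λ Λ' : Gr} (g : P ⟶ Λ) (ψ : Λ ⟶ Λ') :
    coord P Λ' (g ≫ ψ) = (oddSpace P.n).barMap ψ (coord P Λ g) := by
  refine Prod.ext ((map_zero (tensorMap (Gr.Hom.restrict ψ 0) (ContinuousLinearMap.id ℝ PUnit))).symm) ?_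
  apply (tensorPi Λ' P.n).injective
  funext j
  refine Eq.trans ?_ (tensorPi_tensorMap P.n (Gr.Hom.restrict ψ 1) _ j).symm
  change tensorPi Λ' P.n ((tensorPi Λ' P.n).symm (Gr.homEquiv P Λ' (g ≫ ψ))) j =
    Gr.Hom.restrict ψ 1 (tensorPi Λ P.n ((tensorPi Λ P.n).symm (Gr.homEquiv P Λ g)) j)
  rw [LinearEquiv.apply_symm_apply, LinearEquiv.apply_symm_apply]
  rfl

/-- The functor `Λ ↦ Hom(P, Λ)`. -/
def functor (P : Gr) : Gr ⥤ TopCat.{0} where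
  obj Λ := TopCat.of (Pts P Λ)
  map {Λ Λ'} ψ := TopCat.ofHom ⟨fun g : P ⟶ Λ => (g ≫ ψ : P ⟶ Λ'), by
    refine (coordHomeo P Λ').isInducing.continuous_iff.2 ?_
    exact (((oddSpace P.n).barMap ψ).continuous.comp (coordHomeo P Λ).continuous).congr
      fun (g : P ⟶ Λ) => (coord_comp g ψ).symm⟩
  map_id Λ := TopCat.hom_ext (ContinuousMap.ext fun g => Category.comp_id (X := P) (Y := Λ) g)
  map_comp {Λ _ _} φ ψ := TopCat.hom_ext (ContinuousMap.ext fun g =>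
    (Category.assoc (W := P) (X := Λ) g φ ψ).symm)

/-- The global chart of a superpoint. -/
def chart (P : Gr) : Chart (functor P) where
  V := oddSpace P.n
  hom Λ := (coordHomeo P Λ).toOpenPartialHomeomorph
  map_source _ _ _ := mem_univ _
  naturality {Λ _} ψ (g : P ⟶ Λ) _ := coord_comp g ψ

end Superpoint

/-- The superpoint `𝒫(P) ≅ ℝ^{0|n}` of a Grassmann algebra `P = Λ_n`, as a supermanifold:
`𝒫(P)(Λ) = Hom(P, Λ)`. -/
def superpoint (P : Gr) : Supermanifold.{0} where
  functor := Superpoint.functor P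
  t2 Λ := (Superpoint.coordHomeo P Λ).symm.t2Space
  atlas := {Superpoint.chart P}
  cover _ _ := ⟨_, rfl, mem_univ _⟩
  compatible := by
    rintro _ rfl _ rfl Λ
    refine SupersmoothOn.congr (((Superpoint.chart P).hom Λ).isOpen_inter_preimage_symm
      ((Superpoint.chart P).hom Λ).open_source) (f := _root_.id) ?_ ?_
    · exact SupersmoothOn.clm (E := (oddSpace P.n).bar Λ) (F := (oddSpace P.n).bar Λ) (R := Λ.even)
        (ContinuousLinearMap.id ℝ ((oddSpace P.n).bar Λ)) (fun _ _ => rfl) _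
    · intro x _
      exact ((Superpoint.coordHomeo P Λ).apply_symm_apply x).symm

namespace Superpoint

/-- Evaluation at `z ∈ P` of the morphism `P → Λ` with given coordinates. -/
def ev {P : Gr} (Λ : Gr) (z : P.alg) (x : (oddSpace P.n).bar Λ) : Λ.alg :=
  ((coord P Λ).symm x).toAlgHom z

theorem ev_τ {P Λ : Gr} (i : Fin P.n) (x : (oddSpace P.n).bar Λ) : ev Λ (P.τ i) x =
    (tensorPi Λ P.n x.2 i : Λ.alg) := by
  have := Gr.homEquiv_apply P Λ ((coord P Λ).symm x) i
  rw [ev, ← this]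
  simp [coord]

/-- The `i`-th odd coordinate, as a continuous linear map. -/
def oddCoord {P : Gr} (Λ : Gr) (i : Fin P.n) : (oddSpace P.n).bar Λ →L[ℝ] Λ.alg where
  toLinearMap := (Λ.part 1).subtype ∘ₗ LinearMap.proj i ∘ₗ
    (tensorPi Λ P.n).toLinearMap ∘ₗ LinearMap.snd ℝ _ _
  cont := by
    refine Gr.continuous_alg_iff.2 fun l => ?_
    have h : ∀ x : Λ.part 1 ⊗[ℝ] (Fin P.n → ℝ),
        l (tensorPi Λ P.n x i : Λ.alg) =
        contract (Fin P.n → ℝ) (l ∘ₗ (Λ.part 1).subtype) x i := by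
      intro x
      induction x with
      | zero => simp
      | tmul s v => simp [mul_comm]
      | add x y hx hy =>
        simp only [map_add, Pi.add_apply, Submodule.coe_add, hx, hy]
    exact (((continuous_apply i).comp (continuous_contract _)).comp continuous_snd).congr
      fun x => (h x.2).symm

theorem oddCoord_smul {P : Gr} (Λ : Gr) (i : Fin P.n) (a : Λ.even) (x : (oddSpace P.n).bar Λ) :
    oddCoord Λ i (a • x) = a • oddCoord Λ i x := by
  have h : ∀ x : Λ.part 1 ⊗[ℝ] (Fin P.n → ℝ),
      tensorPi Λ P.n (a • x) i =
      a • tensorPi Λ P.n x i := by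
    intro x
    induction x with
    | zero => simp
    | tmul s v => rw [TensorProduct.smul_tmul', tensorPi_tmul, tensorPi_tmul, smul_comm]
    | add x y hx hy => simp only [smul_add, map_add, Pi.add_apply, hx, hy]
  exact congrArg Subtype.val (h x.2)

theorem ev_supersmooth {P : Gr} (Λ : Gr) (z : P.alg) :
    SupersmoothOn Λ.even (ev Λ z) (univ : Set ((oddSpace P.n).bar Λ)) := by
  induction z using ExteriorAlgebra.induction with
  | algebraMap r =>
    refine (SupersmoothOn.const (algebraMap ℝ Λ.alg r) univ).congr isOpen_univ fun x _ => ?_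
    exact (AlgHom.commutes _ r).symm
  | ι v =>
    have hL := SupersmoothOn.clm (R := Λ.even) (E := (oddSpace P.n).bar Λ) (F := Λ.alg)
      (∑ i, v i • oddCoord Λ i) (fun a x => by
        simp only [sum_apply, smul_apply, oddCoord_smul,
          Finset.smul_sum]
        exact Finset.sum_congr rfl fun i _ => smul_comm _ _ _) univ
    refine hL.congr isOpen_univ fun x _ => ?_
    have hv : ExteriorAlgebra.ι ℝ v = ∑ i, v i • P.τ i := by
      conv_lhs => rw [pi_eq_sum_univ' v]
      simp [Gr.τ]
    simp only [sum_apply, smul_apply]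
    rw [ev, hv, map_sum]
    refine Finset.sum_congr rfl fun i _ => ?_
    rw [map_smul]
    exact congrArg (v i • ·) (ev_τ i x).symm
  | mul a b ha hb =>
    refine (SupersmoothOn.mul (R := Λ.even) (A := Λ.alg) ?_ ?_ isOpen_univ ha hb).congr isOpen_univ
      fun x _ => (map_mul _ a b).symm
    · exact fun a x y => (mul_assoc a.1 x y).symm
    · intro a x y
      change a.1 * (x * y) = x * (a.1 * y)
      rw [← mul_assoc, Gr.even_comm Λ a.2 x, mul_assoc]
  | add a b ha hb =>
    exact (ha.add hb).congr isOpen_univ fun x _ => (map_add _ a b).symm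

/-- The linear map `λ ↦ λ_1̄ ⊗ e_i`. -/
def single (n : ℕ) (Λ : Gr) (i : Fin n) : Λ.alg →L[ℝ] (oddSpace n).bar Λ where
  toLinearMap := LinearMap.inr ℝ _ _ ∘ₗ (TensorProduct.mk ℝ (Λ.part 1) (Fin n → ℝ)).flip
    (Pi.single i 1) ∘ₗ Λ.oddProj
  cont := by
    refine continuous_const.prodMk (continuous_tensor_iff.2 fun l => ?_)
    have : ∀ x : Λ.alg, contract (Fin n → ℝ) l (Λ.oddProj x ⊗ₜ Pi.single i 1) =
        (l ∘ₗ Λ.oddProj) x • Pi.single i 1 := fun x => contract_tmul _ _ _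
    exact ((Gr.continuous_functional (l ∘ₗ Λ.oddProj)).smul continuous_const).congr
      fun x => (this x).symm

theorem _root_.SuperGeometry.Gr.oddProj_smul (Λ : Gr) (a : Λ.even) (x : Λ.alg) :
    Λ.oddProj (a • x) = a • Λ.oddProj x := by
  have hc : IsCompl (Λ.part 1) (Λ.part 0) := (CliffordAlgebra.evenOdd_isCompl _).symm
  have hx : x ∈ Λ.part 1 ⊔ Λ.part 0 := by rw [hc.sup_eq_top]; trivial
  obtain ⟨y, hy, z, hz, rfl⟩ := Submodule.mem_sup.1 hx
  have h0 : (a • z : Λ.alg) ∈ Λ.part 0 := by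
    have := SetLike.mul_mem_graded a.2 hz
    rwa [zero_add] at this
  have h1 := Submodule.projectionOnto_apply_left hc (a • (⟨y, hy⟩ : Λ.part 1))
  have h2 := Submodule.projectionOnto_apply_left hc ⟨y, hy⟩
  have h3 := (Submodule.projectionOnto_apply_eq_zero_iff hc).2 h0
  have h4 := (Submodule.projectionOnto_apply_eq_zero_iff hc).2 hz
  rw [smul_add, map_add, map_add]
  have e : ∀ w : Λ.alg, Λ.oddProj w = Submodule.projectionOnto _ _ hc w := fun _ => rfl
  rw [e, e, e, e, h3, h4, h2, add_zero, add_zero]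
  exact h1

theorem _root_.SuperGeometry.Gr.oddProj_odd (Λ : Gr) (x : Λ.part 1) : Λ.oddProj x = x :=
  Submodule.projectionOnto_apply_left _ x

theorem single_smul (n : ℕ) (Λ : Gr) (i : Fin n) (a : Λ.even) (x : Λ.alg) :
    single n Λ i (a • x) = a • single n Λ i x := by
  refine Prod.ext (smul_zero a).symm ?_
  change Λ.oddProj (a • x) ⊗ₜ Pi.single i 1 = a • (Λ.oddProj x ⊗ₜ Pi.single i 1)
  rw [Gr.oddProj_smul, TensorProduct.smul_tmul']

theorem coord_eq_sum {P Λ : Gr} (g : P ⟶ Λ) :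
    coord P Λ g = ∑ i, single P.n Λ i (g.toAlgHom (P.τ i)) := by
  have h0 : ∀ i, single P.n Λ i (g.toAlgHom (P.τ i)) =
      ((0, Gr.homEquiv P Λ g i ⊗ₜ Pi.single i 1) : (oddSpace P.n).bar Λ) := by
    intro i
    refine Prod.ext rfl ?_
    change Λ.oddProj (Gr.homEquiv P Λ g i : Λ.alg) ⊗ₜ Pi.single i 1 = _
    rw [Gr.oddProj_odd]
  simp only [h0]
  refine Prod.ext (by simp [coord, Prod.fst_sum]) ?_
  rw [Prod.snd_sum]
  apply (tensorPi Λ P.n).injective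
  funext j
  simp [coord, Finset.sum_apply, Pi.single_apply]

/-- The morphism `𝒫(φ) : 𝒫(Q) → 𝒫(P)` induced by `φ : P ⟶ Q`, that is, `g ↦ g ∘ φ`. -/
def map {P Q : Gr} (φ : P ⟶ Q) : Supermanifold.Hom (superpoint Q) (superpoint P) :=
  have key (Λ : Gr) : SupersmoothOn Λ.even
      (fun x => coord P Λ (φ ≫ (coord Q Λ).symm x)) univ := by
    have h : (fun x => coord P Λ (φ ≫ (coord Q Λ).symm x)) =
        fun x => ∑ i, single P.n Λ i (ev Λ (φ.toAlgHom (P.τ i)) x) := by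
      funext x
      exact coord_eq_sum _
    rw [h]
    refine SupersmoothOn.sum _ fun i => SupersmoothOn.comp isOpen_univ
      (SupersmoothOn.clm (E := Λ.alg) (F := (oddSpace P.n).bar Λ) (R := Λ.even)
        (single P.n Λ i) (single_smul P.n Λ i) univ)
      (ev_supersmooth Λ (φ.toAlgHom (P.τ i))) fun _ _ => mem_univ _
  { app := fun Λ (g : Q ⟶ Λ) => (φ ≫ g : P ⟶ Λ)
    naturality := fun {Λ _} ψ (g : Q ⟶ Λ) => (Category.assoc φ g ψ).symm
    continuous := fun Λ => by
      refine (coordHomeo P Λ).isInducing.continuous_iff.2 ?_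
      have h := (continuousOn_univ.1 (key Λ).continuousOn).comp (coordHomeo Q Λ).continuous
      refine h.congr fun g => ?_
      exact congrArg (fun g : Q ⟶ Λ => coord P Λ (φ ≫ g)) ((coord Q Λ).symm_apply_apply g)
    supersmooth := by
      rintro _ rfl _ rfl Λ
      exact (key Λ).mono (subset_univ _) }

end Superpoint

/-! ## The inner Hom functor and composition -/

namespace Supermanifold

/-- The set `Hom(M, N)(P) = Hom(𝒫(P) × M, N)` of `P`-points of the inner Hom object. -/
abbrev InnerHom (M : Supermanifold.{u}) (N : Supermanifold.{v}) (P : Gr) : Type (max u v) :=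
  Hom ((superpoint P).prod M) N

namespace InnerHom

/-- `𝒫(φ) × id : 𝒫(Q) × M → 𝒫(P) × M` for `φ : P ⟶ Q`. -/
def baseChange (M : Supermanifold.{u}) {P Q : Gr} (φ : P ⟶ Q) :
    Hom ((superpoint Q).prod M) ((superpoint P).prod M) :=
  Hom.lift ((Superpoint.map φ).comp (Hom.fst (superpoint Q) M)) (Hom.snd (superpoint Q) M)

/-- Functoriality of the inner Hom: `σ ↦ σ ∘ (𝒫(φ) × id)`. -/
def map {M : Supermanifold.{u}} {N : Supermanifold.{v}} {P Q : Gr} (φ : P ⟶ Q)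
    (σ : InnerHom M N P) : InnerHom M N Q :=
  σ.comp (baseChange M φ)

theorem map_app {M : Supermanifold.{u}} {N : Supermanifold.{v}} {P Q : Gr} (φ : P ⟶ Q)
    (σ : InnerHom M N P) (Λ : Gr) (g : Q ⟶ Λ) (x : M.pt Λ) :
    (map φ σ).app Λ (g, x) = σ.app Λ ((φ ≫ g : P ⟶ Λ), x) := rfl

/-- Composition of `P`-points of inner Homs: `g ∘ (id_{𝒫(P)} × f)`, with
`id_{𝒫(P)} × f = (pr_{𝒫(P)}, f) : 𝒫(P) × L → 𝒫(P) × M`. -/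
def comp {L : Supermanifold.{u}} {M : Supermanifold.{v}} {N : Supermanifold.{w}} {P : Gr}
    (g : InnerHom M N P) (f : InnerHom L M P) : InnerHom L N P :=
  Hom.comp g (Hom.lift (Hom.fst (superpoint P) L) f)

theorem comp_app {L : Supermanifold.{u}} {M : Supermanifold.{v}} {N : Supermanifold.{w}} {P : Gr}
    (g : InnerHom M N P) (f : InnerHom L M P) (Λ : Gr) (q : P ⟶ Λ) (x : L.pt Λ) :
    (comp g f).app Λ (q, x) = g.app Λ (q, f.app Λ (q, x)) := rfl

/-- The `P`-points of the inner Hom of `M` with itself form a monoid under composition, whose unit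
is the projection `𝒫(P) × M → M`. -/
instance (M : Supermanifold.{u}) (P : Gr) : Monoid (InnerHom M M P) where
  mul g f := comp g f
  one := Hom.snd (superpoint P) M
  mul_assoc _ _ _ := rfl
  one_mul _ := rfl
  mul_one _ := rfl

theorem mul_def {M : Supermanifold.{u}} {P : Gr} (g f : InnerHom M M P) : g * f = comp g f := rfl

theorem one_def {M : Supermanifold.{u}} {P : Gr} :
    (1 : InnerHom M M P) = Hom.snd (superpoint P) M := rfl

/-- `InnerHom.map` is compatible with composition. -/
def mapMonoidHom (M : Supermanifold.{u}) {P Q : Gr} (φ : P ⟶ Q) :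
    InnerHom M M P →* InnerHom M M Q where
  toFun := map φ
  map_one' := rfl
  map_mul' _ _ := rfl

end InnerHom

/-- The monoid of endomorphisms of a supermanifold. -/
instance (M : Supermanifold.{u}) : Monoid (Hom M M) where
  mul g f := g.comp f
  one := Hom.id M
  mul_assoc _ _ _ := rfl
  one_mul _ := rfl
  mul_one _ := rfl

/-- The group `Aut(M)` of automorphisms of a supermanifold. -/
abbrev Aut (M : Supermanifold.{u}) : Type u := (Hom M M)ˣ

end Supermanifold

/-! ## Supergroups -/

/-- A supergroup, that is, a group object in the category of functors `Gr ⥤ Sets`; equivalently, a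
functor from Grassmann algebras to groups. -/
abbrev Supergroup : Type (u + 1) := Gr ⥤ GrpCat.{u}

/-- The constant supergroup `Λ ↦ A`. -/
abbrev Supergroup.constant (A : Type u) [Group A] : Supergroup.{u} :=
  (Functor.const Gr).obj (GrpCat.of A)

/-- A super subgroup of a supergroup: a subfunctor consisting of subgroups. -/
structure SuperSubgroup (G : Supergroup.{u}) where
  /-- the subgroups -/
  carrier : ∀ Λ : Gr, Subgroup (G.obj Λ)
  map_mem : ∀ {Λ Λ' : Gr} (φ : Λ ⟶ Λ'), ∀ x ∈ carrier Λ, G.map φ x ∈ carrier Λ'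

namespace SuperSubgroup

/-- A super subgroup is normal if all its values are normal subgroups. -/
def Normal {G : Supergroup.{u}} (N : SuperSubgroup G) : Prop := ∀ Λ, (N.carrier Λ).Normal

/-- A super subgroup as a supergroup. -/
def toSupergroup {G : Supergroup.{u}} (N : SuperSubgroup G) : Supergroup.{u} where
  obj Λ := GrpCat.of (N.carrier Λ)
  map φ := GrpCat.ofHom (((G.map φ).hom.comp (N.carrier _).subtype).codRestrict (N.carrier _)
    fun x => N.map_mem φ x.1 x.2)
  map_id Λ := by
    ext x
    simp
  map_comp φ ψ := by
    ext x
    simp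
    rfl

/-- The inclusion of a super subgroup. -/
def incl {G : Supergroup.{u}} (N : SuperSubgroup G) : N.toSupergroup ⟶ G where
  app Λ := GrpCat.ofHom (N.carrier Λ).subtype

end SuperSubgroup

/-- An action of a supergroup `A` on a supergroup `N` by automorphisms of supergroups: compatible
actions of the groups `A(Λ)` on the groups `N(Λ)` by group automorphisms. -/
structure SuperAction (A N : Supergroup.{u}) where
  /-- the actions -/
  act : ∀ Λ : Gr, A.obj Λ →* MulAut (N.obj Λ)
  naturality : ∀ {Λ Λ' : Gr} (φ : Λ ⟶ Λ') (a : A.obj Λ) (n : N.obj Λ),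
    N.map φ (act Λ a n) = act Λ' (A.map φ a) (N.map φ n)

/-- The semidirect product `N ⋊ A` of supergroups: `Λ ↦ N(Λ) ⋊ A(Λ)`. -/
def SuperAction.semidirectProduct {A N : Supergroup.{u}} (ρ : SuperAction A N) :
    Supergroup.{u} where
  obj Λ := GrpCat.of (N.obj Λ ⋊[ρ.act Λ] A.obj Λ)
  map {Λ Λ'} φ := GrpCat.ofHom (SemidirectProduct.map (N.map φ).hom (A.map φ).hom fun a => by
    ext n
    exact ρ.naturality φ a n)
  map_id Λ := by
    ext x
    · simp
    · simp
  map_comp φ ψ := by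
    ext x
    · simp
    · simp

/-! ## The diffeomorphism supergroup -/

/-- The diffeomorphism supergroup: `SDiff(M)(Λ)` is the group of invertible elements of
`Hom(M, M)(Λ)`, and `SDiff(M)(φ)` is the restriction of `Hom(M, M)(φ)`. -/
def SDiff (M : Supermanifold.{u}) : Supergroup.{u} where
  obj Λ := GrpCat.of (M.InnerHom M Λ)ˣ
  map φ := GrpCat.ofHom (Units.map (Supermanifold.InnerHom.mapMonoidHom M φ))
  map_id Λ := by
    ext f Λ' x
    exact congrArg (fun g : Λ ⟶ Λ' => (f.val).app Λ' (g, x.2)) (Category.id_comp (X := Λ) x.1)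
  map_comp {Λ _ _} φ ψ := by
    ext f Λ' x
    exact congrArg (fun g : Λ ⟶ Λ' => (f.val).app Λ' (g, x.2)) (Category.assoc φ ψ x.1)

namespace Supermanifold

/-- The morphism from `M` to the one-point supermanifold `𝒫(ℝ)`. -/
def toPoint (M : Supermanifold.{u}) : Hom M (superpoint Gr.base) where
  app Λ _ := Gr.c Λ
  naturality {_ Λ'} φ _ := (Gr.hom_ext fun i => i.elim0 : Gr.c Λ' = Gr.c _ ≫ φ)
  continuous _ := continuous_const
  supersmooth _ _ d _ Λ := SupersmoothOn.const (d.hom Λ (Gr.c Λ : Gr.base ⟶ Λ)) _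

/-- The identification of the `ℝ`-points of the inner Hom with endomorphisms of `M`, which comes
from the isomorphism `𝒫(ℝ) × M ≅ M` given by the projection. -/
def endEquiv (M : Supermanifold.{u}) : Hom M M ≃* InnerHom M M Gr.base where
  toFun f := f.comp (Hom.snd (superpoint Gr.base) M)
  invFun σ := Hom.comp (N := (superpoint Gr.base).prod M) σ (Hom.lift M.toPoint (Hom.id M))
  left_inv _ := rfl
  right_inv σ := by
    refine Hom.ext' fun Λ x => ?_
    exact congrArg (fun g : Gr.base ⟶ Λ => σ.app Λ (g, x.2))
      (Gr.hom_ext fun i => i.elim0 : Gr.c Λ = x.1)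
  map_mul' _ _ := rfl

/-- `Aut(M) ≅ SDiff(M)(ℝ)`. -/
def autEquiv (M : Supermanifold.{u}) : M.Aut ≃* (SDiff M).obj Gr.base :=
  Units.mapEquiv M.endEquiv

/-- The homomorphism `SDiff(M)(c_Λ)` from `Aut(M) = SDiff(M)(ℝ)` to `SDiff(M)(Λ)`. -/
def autHom (M : Supermanifold.{u}) (Λ : Gr) : M.Aut →* (SDiff M).obj Λ :=
  ((SDiff M).map (Gr.c Λ)).hom.comp M.autEquiv.toMonoidHom

end Supermanifold

end SuperGeometry

end

open SuperGeometry

universe u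

/-! The algebra `Λ_0 = ℝ` is a zero object of the category of Grassmann algebras. A morphism is
determined by its values on the odd generators, and these values are odd. Since `Λ_0` has no odd
element besides zero, `ε_Λ` is the only morphism from `Λ` to it; since it has no generators, `c_Λ`
is the only morphism from it to `Λ`.

Everything else works for an arbitrary supergroup `G`. Because morphisms from and to `Λ_0` are
unique, the maps `G(ε_Λ)` form a natural transformation from `G` to the constant supergroup `G(ℝ)`
(`map_ε_map`), the maps `G(c_Λ)` form one in the opposite direction (`map_map_c`), and the latter is
a section of the former (`map_ε_map_c`). Hence `G` is a split extension of a constant supergroup by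
the kernel of `G(ε)`, and a split extension is a semidirect product: every `g` equals `(g s⁻¹) s`
with `s = G(c_Λ)(G(ε_Λ)(g))`, and the kernel meets the image of the section only in `1`
(`isComplement_augmentationKer`). Naturality of the section makes the conjugation actions, and the
bijections `(n, a) ↦ n α(a)`, compatible with all morphisms of Grassmann algebras.

The theorem is the case of `SDiff(M)`, with `G(ℝ)` replaced by `Aut(M)` along `autEquiv`. Charts and
supersmoothness play no further role: they are used up in showing that `SDiff(M)` is a functor to
groups and in identifying its value at `ℝ`. -/

namespace SuperGeometry

/-! ### The zero object of the category of Grassmann algebras -/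

namespace Gr

/-- Odd elements are sums of products containing an odd number of vectors, and the generating space
`Fin 0 → ℝ` has only the zero vector. This is what makes `Λ_0` terminal. -/
theorem eq_zero_of_mem_part_one_base {x : base.alg} (hx : x ∈ base.part 1) : x = 0 := by
  induction x, hx using CliffordAlgebra.odd_induction with
  | ι v => rw [Subsingleton.elim v 0, map_zero]
  | add a b _ _ ha hb => rw [ha, hb, add_zero]
  | ι_mul_ι_mul m₁ m₂ a _ ha => rw [ha, mul_zero]

/-- `Λ_0 = ℝ` is a terminal object. -/
theorem hom_base_ext {Λ : Gr} (φ ψ : Λ ⟶ base) : φ = ψ :=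
  -- Both morphisms send the odd generator `τ_i` to an odd element of `Λ_0`, which can only be zero.
  hom_ext fun i => by
    rw [eq_zero_of_mem_part_one_base (φ.map_part 1 _ (Λ.τ_mem i)),
      eq_zero_of_mem_part_one_base (ψ.map_part 1 _ (Λ.τ_mem i))]

/-- `Λ_0 = ℝ` is an initial object. -/
theorem base_hom_ext {Λ : Gr} (φ ψ : base ⟶ Λ) : φ = ψ :=
  -- Agreement on generators is vacuous, as they are indexed by `Fin 0`.
  hom_ext fun i => i.elim0

end Gr

/-! ### The split augmentation of an arbitrary supergroup -/

namespace Supergroup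

variable (G : Supergroup.{u})

theorem map_comp_apply {Λ Λ' Λ'' : Gr} (φ : Λ ⟶ Λ') (ψ : Λ' ⟶ Λ'') (x : G.obj Λ) :
    (G.map ψ).hom ((G.map φ).hom x) = (G.map (φ ≫ ψ)).hom x := by
  rw [G.map_comp]
  rfl

/-- Terminality of `Λ_0` forces `φ ≫ ε_Λ' = ε_Λ`. The augmentations are therefore natural, so that
their kernels form a subfunctor. -/
theorem map_ε_map {Λ Λ' : Gr} (φ : Λ ⟶ Λ') (x : G.obj Λ) :
    (G.map (Gr.ε Λ')).hom ((G.map φ).hom x) = (G.map (Gr.ε Λ)).hom x := by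
  rw [map_comp_apply, Gr.hom_base_ext (φ ≫ Gr.ε Λ') (Gr.ε Λ)]

/-- Dual to `map_ε_map`: initiality of `Λ_0` forces `c_Λ ≫ φ = c_Λ'`. The images of elements of
`G(ℝ)` are thus preserved by all `G(φ)`, which is the compatibility needed for an action of a
constant supergroup. -/
theorem map_map_c {Λ Λ' : Gr} (φ : Λ ⟶ Λ') (x : G.obj Gr.base) :
    (G.map φ).hom ((G.map (Gr.c Λ)).hom x) = (G.map (Gr.c Λ')).hom x := by
  rw [map_comp_apply, Gr.base_hom_ext (Gr.c Λ ≫ φ) (Gr.c Λ')]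

/-- The only endomorphism of `Λ_0` is the identity. This splits the augmentation; injectivity of the
section and the complement property both come from it. -/
theorem map_ε_map_c (Λ : Gr) (x : G.obj Gr.base) :
    (G.map (Gr.ε Λ)).hom ((G.map (Gr.c Λ)).hom x) = x := by
  rw [map_comp_apply, Gr.base_hom_ext (Gr.c Λ ≫ Gr.ε Λ) (𝟙 Gr.base), G.map_id]
  rfl

/-- The kernels of the maps `G(ε_Λ) : G(Λ) → G(ℝ)`. -/
def augmentationKer : SuperSubgroup G where
  carrier Λ := (G.map (Gr.ε Λ)).hom.ker
  -- Membership in the kernel is by definition the equation `G(ε_Λ)(x) = 1`, and `G(φ)(x)` has the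
  -- same augmentation as `x`.
  map_mem φ x hx := (G.map_ε_map φ x).trans hx

theorem augmentationKer_normal : G.augmentationKer.Normal := fun Λ =>
  inferInstanceAs (G.map (Gr.ε Λ)).hom.ker.Normal

end Supergroup

/-! ### Conjugation actions and internal semidirect products -/

namespace SuperSubgroup

variable {G : Supergroup.{u}} {N : SuperSubgroup G} {A : Type u} [Group A]

/-- The action by conjugation of a group `A` on a normal super subgroup of `G`, through
a compatible family of homomorphisms `A → G(Λ)`. -/
def conjAction (hN : N.Normal) (α : ∀ Λ : Gr, A →* G.obj Λ)
    (hα : ∀ {Λ Λ' : Gr} (φ : Λ ⟶ Λ') (a : A), (G.map φ).hom (α Λ a) = α Λ' a) :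
    SuperAction (Supergroup.constant A) N.toSupergroup where
  act Λ := haveI := hN Λ; (MulAut.conjNormal (H := N.carrier Λ)).comp (α Λ)
  naturality {Λ Λ'} φ a n := by
    have := hN Λ
    have := hN Λ'
    refine Subtype.ext ?_
    -- Inclusions into `G` are injective, so the equation can be checked there. The acting
    -- supergroup is constant, hence `a` itself is not moved by `φ`; what remains is that `G(φ)` is
    -- multiplicative and takes `α_Λ(a)` to `α_Λ'(a)`.
    change (G.map φ).hom (α Λ a * (N.incl.app Λ).hom n * (α Λ a)⁻¹) =
      α Λ' a * (G.map φ).hom ((N.incl.app Λ).hom n) * (α Λ' a)⁻¹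
    rw [map_mul, map_mul, map_inv, hα]

variable (hN : N.Normal) (α : ∀ Λ : Gr, A →* G.obj Λ)
  (hα : ∀ {Λ Λ' : Gr} (φ : Λ ⟶ Λ') (a : A), (G.map φ).hom (α Λ a) = α Λ' a)

/-- Determines the action completely, because the inclusion is injective; this is the formula by
which the main statement pins the action down. -/
theorem incl_conjAction (Λ : Gr) (a : A) (n : N.toSupergroup.obj Λ) :
    (N.incl.app Λ).hom ((conjAction hN α hα).act Λ a n) =
      α Λ a * (N.incl.app Λ).hom n * (α Λ a)⁻¹ := rfl

/-- The homomorphism `(n, a) ↦ n α(a)` from `N(Λ) ⋊ A` to `G(Λ)`. -/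
def semidirectHom (Λ : Gr) : (conjAction hN α hα).semidirectProduct.obj Λ →* G.obj Λ :=
  SemidirectProduct.lift (φ := (conjAction hN α hα).act Λ) (N.incl.app Λ).hom (α Λ) fun a => by
    -- The condition for the two homomorphisms to glue is that `α(a)` acts on the image of `N(Λ)` by
    -- conjugation, which is how the action was defined.
    ext n
    rfl

/-- Being complements means that multiplication `N(Λ) × α(A) → G(Λ)` is bijective; injectivity of
`α` then allows the factor `α(A)` to be replaced by `A`. -/
theorem semidirectHom_bijective (hc : ∀ Λ, (N.carrier Λ).IsComplement' (α Λ).range)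
    (hi : ∀ Λ, Function.Injective (α Λ)) (Λ : Gr) :
    Function.Bijective (semidirectHom hN α hα Λ) := by
  constructor
  · rintro ⟨n, a⟩ ⟨n', a'⟩ h
    -- Unfolded, `h` reads `n α(a) = n' α(a')`, an equality of two values of the multiplication map
    -- of the complements.
    have h' := (hc Λ).1 (a₁ := ((n : N.carrier Λ), ⟨α Λ a, a, rfl⟩))
      (a₂ := ((n' : N.carrier Λ), ⟨α Λ a', a', rfl⟩)) h
    obtain ⟨rfl, h2⟩ := Prod.ext_iff.1 h'
    obtain rfl := hi Λ (Subtype.ext_iff.1 h2)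
    rfl
  · intro g
    obtain ⟨⟨n, _, a, rfl⟩, h⟩ := (hc Λ).2 g
    exact ⟨⟨n, a⟩, h⟩

/-- The isomorphism of supergroups `N ⋊ A ≅ G`, `(n, a) ↦ n α(a)`. -/
noncomputable def semidirectIso (hc : ∀ Λ, (N.carrier Λ).IsComplement' (α Λ).range)
    (hi : ∀ Λ, Function.Injective (α Λ)) : (conjAction hN α hα).semidirectProduct ≅ G :=
  NatIso.ofComponents
    (fun Λ => (MulEquiv.ofBijective _ (semidirectHom_bijective hN α hα hc hi Λ)).toGrpIso)
    fun {Λ Λ'} φ => by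
      ext ⟨n, a⟩
      -- Along the semidirect product, `φ` changes `n` only, since the second factor is constant.
      -- The square commutes because `G(φ)` takes `α_Λ(a)` to `α_Λ'(a)`.
      change (G.map φ).hom ((N.incl.app Λ).hom n) * α Λ' a =
        (G.map φ).hom ((N.incl.app Λ).hom n * α Λ a)
      rw [map_mul, hα]

end SuperSubgroup

/-- The kernel of a split surjection is complementary to the image of the splitting. The isomorphism
`e` does not affect that image; it is included so that the homomorphism matches `autHom` by
definition. -/
theorem Supergroup.isComplement_augmentationKer (G : Supergroup.{u}) {A : Type u} [Group A]
    (e : A ≃* G.obj Gr.base) (Λ : Gr) :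
    (G.augmentationKer.carrier Λ).IsComplement'
      ((G.map (Gr.c Λ)).hom.comp e.toMonoidHom).range := by
  refine Subgroup.isComplement'_of_disjoint_and_mul_eq_univ ?_ (eq_univ_of_forall fun g => ?_)
  · rw [Subgroup.disjoint_def]
    rintro _ hx ⟨a, rfl⟩
    -- Applying `G(ε_Λ)` to an element of the image of the section recovers `e a`, while the kernel
    -- condition says that the result is `1`.
    have h : e a = 1 := (G.map_ε_map_c Λ (e a)).symm.trans hx
    change (G.map (Gr.c Λ)).hom (e a) = 1
    rw [h, map_one]
  · let s := (G.map (Gr.c Λ)).hom ((G.map (Gr.ε Λ)).hom g)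
    refine mem_mul.2 ⟨g * s⁻¹, ?_, s, ⟨e.symm ((G.map (Gr.ε Λ)).hom g), ?_⟩, ?_⟩
    · change (G.map (Gr.ε Λ)).hom (g * s⁻¹) = 1
      rw [map_mul, map_inv, G.map_ε_map_c, mul_inv_cancel]
    · exact congrArg (G.map (Gr.c Λ)).hom (e.apply_symm_apply _)
    · exact inv_mul_cancel_right g s

/-! ### Specialization to the diffeomorphism supergroup -/

namespace Supermanifold

variable (M : Supermanifold.{u})

theorem map_autHom {Λ Λ' : Gr} (φ : Λ ⟶ Λ') (a : M.Aut) :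
    ((SDiff M).map φ).hom (M.autHom Λ a) = M.autHom Λ' a :=
  (SDiff M).map_map_c φ (M.autEquiv a)

/-- `SDiff(M)(ε_Λ)` is a left inverse of `SDiff(M)(c_Λ)`, and `autEquiv` is injective. -/
theorem autHom_injective (Λ : Gr) : Function.Injective (M.autHom Λ) := fun a b h =>
  M.autEquiv.injective <| by
    rw [← (SDiff M).map_ε_map_c Λ (M.autEquiv a), ← (SDiff M).map_ε_map_c Λ (M.autEquiv b)]
    exact congrArg ((SDiff M).map (Gr.ε Λ)).hom h

end Supermanifold

end SuperGeometry

/-- The existential quantifiers leave no freedom: the kernels determine `N`, the conjugation formula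
determines `ρ` since inclusions are injective, and the last formula gives `e` on every pair. -/
theorem mainTheorem7 (M : Supermanifold.{u}) :
    ∃ N : SuperSubgroup (SDiff M),
      (∀ Λ : Gr, N.carrier Λ = ((SDiff M).map (Gr.ε Λ)).hom.ker) ∧ N.Normal ∧
      ∃ ρ : SuperAction (Supergroup.constant M.Aut) N.toSupergroup,
        (∀ (Λ : Gr) (a : M.Aut) (n : N.toSupergroup.obj Λ),
          (N.incl.app Λ).hom (ρ.act Λ a n) =
            M.autHom Λ a * (N.incl.app Λ).hom n * (M.autHom Λ a)⁻¹) ∧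
        ∃ e : ρ.semidirectProduct ≅ SDiff M,
          ∀ (Λ : Gr) (n : N.toSupergroup.obj Λ) (a : M.Aut),
            (e.hom.app Λ).hom (SemidirectProduct.mk n a) =
              (N.incl.app Λ).hom n * M.autHom Λ a :=
  have hN := (SDiff M).augmentationKer_normal
  ⟨(SDiff M).augmentationKer, fun _ => rfl, hN,
    SuperSubgroup.conjAction hN M.autHom M.map_autHom,
    SuperSubgroup.incl_conjAction hN M.autHom M.map_autHom,
    SuperSubgroup.semidirectIso hN M.autHom M.map_autHom
      ((SDiff M).isComplement_augmentationKer M.autEquiv) M.autHom_injective,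
    -- The components of the isomorphism are built from `SemidirectProduct.lift`, whose value at
    -- `(n, a)` is by definition the product of the two images.
    fun _ _ _ => rfl⟩
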